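/- A probabilistic automaton $\mathcal A$ consists of a finite set $Q$ of states with an initial state $q_\iota$, a finite non-empty alphabet $\Sigma$ and, for every $\sigma\in\Sigma$, a stochastic matrix $M_\sigma$ on $Q$; let $F\subseteq Q$ be a set of accepting states. An infinite word $w=w_1w_2\cdots\in\Sigma^\omega$ induces the probability measure $\mathbb P^w_{\mathcal A}$ on infinite state sequences $(q_0,q_1,\dots)$ with $q_0=q_\iota$ under which the $n$-th step is made according to $M_{w_n}$. Put $\mathrm{Safe}(F)=\{\pi : \forall i,\ \pi_i\in F\}$ and $\mathrm{Reach}(F)=\{\pi : \exists i,\ \pi_i\in F\}$. A state $q$ is absorbing if $M_\sigma(q,q)=1$ for all $\sigma$. The automaton is absorbing if for every non-absorbing state $q$ and every $\sigma\in\Sigma$ there is an absorbing state $q'$ with $M_\sigma(q,q')>0$; it is acceptance-absorbing if every state of $F$ is absorbing. **Theorem.** Fix any rational $\lambda$ with $0<\lambda<1$. Each of the following problems, whose input is (a finite description of) a probabilistic automaton with rational transition probabilities and a set $F$ of accepting states, is undecidable, both for the class of absorbing automata with $\Phi=\mathrm{Safe}(F)$ and for the class of acceptance-absorbing automata with $\Phi=\mathrm{Reach}(F)$: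 1. (quantitative equality) is there a word $w\in\Sigma^\omega$ with $\mathbb P^w_{\mathcal A}(\Phi)=\lambda$? 2. (quantitative existence) is there a word $w\in\Sigma^\omega$ with $\mathbb P^w_{\mathcal A}(\Phi)>\lambda$? 3. (quantitative value) is $\sup_{w\in\Sigma^\omega}\mathbb P^w_{\mathcal A}(\Phi)>\lambda$? 4. (quantitative value, $\varepsilon$-form) is there for every $\varepsilon>0$ a word $w\in\Sigma^\omega$ with $\mathbb P^w_{\mathcal A}(\Phi)>\lambda-\varepsilon$? Here undecidable means that no computable function gives the correct yes/no answer on all descriptions of automata of the class (whatever it does on other inputs). -/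

import Mathlib

open MeasureTheory ProbabilityTheory

noncomputable section

/-- A probabilistic automaton with finite state set `Q` and finite alphabet `S`: an initial state
and, for every letter, a transition probability matrix. -/
structure ProbAutomaton (Q S : Type) [Fintype Q] where
  init : Q
  trans : S → Q → Q → ℝ
  trans_nonneg : ∀ a q q', 0 ≤ trans a q q'
  trans_sum : ∀ a q, ∑ q', trans a q q' = 1

namespace ProbAutomaton

variable {Q S : Type} [Fintype Q] [MeasurableSpace Q] [MeasurableSingletonClass Q]

/-- The distribution of the next state, as a kernel, when the letter `a` is read. -/
def stepKernel (A : ProbAutomaton Q S) (a : S) : Kernel Q Q :=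
  Kernel.ofFunOfCountable fun q => ∑ q', ENNReal.ofReal (A.trans a q q') • Measure.dirac q'

instance (A : ProbAutomaton Q S) (a : S) : IsMarkovKernel (A.stepKernel a) where
  isProbabilityMeasure q := by
    constructor
    change (∑ q', ENNReal.ofReal (A.trans a q q') • Measure.dirac q') Set.univ = 1
    simp [← ENNReal.ofReal_sum_of_nonneg fun q' _ => A.trans_nonneg a q q', A.trans_sum]

/-- The next state given the history `q₀, …, qₙ`, on the infinite word `w`: the letter `w n` is read
in state `qₙ`. -/
def historyKernel (A : ProbAutomaton Q S) (w : ℕ → S) (n : ℕ) :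
    Kernel ((i : Finset.Iic n) → (fun _ : ℕ => Q) i) Q :=
  (A.stepKernel (w n)).comap (fun x => x ⟨n, Finset.mem_Iic.2 le_rfl⟩) (measurable_pi_apply _)

instance (A : ProbAutomaton Q S) (w : ℕ → S) (n : ℕ) : IsMarkovKernel (A.historyKernel w n) := by
  unfold historyKernel; infer_instance

/-- The probability measure on infinite state sequences induced by the infinite word `w`: the
sequence starts in the initial state and moves according to the matrices of the letters of `w`. -/
def pathMeasure (A : ProbAutomaton Q S) (w : ℕ → S) : Measure (ℕ → Q) :=
  Kernel.traj (X := fun _ : ℕ => Q) (A.historyKernel w) 0 (fun _ => A.init)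

/-- The probability that a path satisfies the (boolean) condition `Φ` on the word `w`. -/
def acceptProb (A : ProbAutomaton Q S) (Φ : Set (ℕ → Q)) (w : ℕ → S) : ℝ :=
  (A.pathMeasure w).real Φ

/-- Quantitative equality problem: some infinite word has acceptance probability exactly `lam`. -/
def Equality (A : ProbAutomaton Q S) (Φ : Set (ℕ → Q)) (lam : ℝ) : Prop :=
  ∃ w : ℕ → S, A.acceptProb Φ w = lam

/-- Quantitative existence problem: some infinite word has acceptance probability `> lam`. -/
def Existence (A : ProbAutomaton Q S) (Φ : Set (ℕ → Q)) (lam : ℝ) : Prop :=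
  ∃ w : ℕ → S, A.acceptProb Φ w > lam

/-- Quantitative value problem: the supremum of the acceptance probabilities is `> lam`. -/
def Value (A : ProbAutomaton Q S) (Φ : Set (ℕ → Q)) (lam : ℝ) : Prop :=
  lam < (⨆ w : ℕ → S, A.acceptProb Φ w)

/-- Quantitative value problem, `ε`-form: `lam` is exceeded up to every `ε > 0`. -/
def ApproxValue (A : ProbAutomaton Q S) (Φ : Set (ℕ → Q)) (lam : ℝ) : Prop :=
  ∀ ε : ℝ, 0 < ε → ∃ w : ℕ → S, A.acceptProb Φ w > lam - ε

end ProbAutomaton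

namespace ProbAutomaton

variable {Q S : Type} [Fintype Q]

/-- A state is absorbing if every letter keeps it fixed with probability one. -/
def IsAbsorbingState (A : ProbAutomaton Q S) (q : Q) : Prop :=
  ∀ a, A.trans a q q = 1

/-- An automaton is absorbing if from every non-absorbing state every letter leads to some
absorbing state with positive probability. -/
def IsAbsorbing (A : ProbAutomaton Q S) : Prop :=
  ∀ a q, ¬ A.IsAbsorbingState q → ∃ q', A.IsAbsorbingState q' ∧ 0 < A.trans a q q'

/-- An automaton with accepting states `F` is acceptance-absorbing if all states of `F` are
absorbing. -/
def IsAcceptanceAbsorbing (A : ProbAutomaton Q S) (F : Set Q) : Prop :=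
  ∀ q ∈ F, A.IsAbsorbingState q

end ProbAutomaton

/-- The safety condition: only states of `F` are visited. -/
def Safe {Q : Type} (F : Set Q) : Set (ℕ → Q) := {π | ∀ i, π i ∈ F}

/-- The reachability condition: some state of `F` is visited. -/
def Reach {Q : Type} (F : Set Q) : Set (ℕ → Q) := {π | ∃ i, π i ∈ F}

/-- Finite descriptions of automata with rational transition probabilities and a set of accepting
states, as they are given to an algorithm: the number of states, the number of letters, the initial
state, the list of accepting states, and a table whose entry at `a`, `q`, `q'` is the pair of
numerator and denominator of the probability to go from `q` to `q'` on the letter `a`. -/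
abbrev AutomatonCode : Type :=
  ℕ × ℕ × ℕ × List ℕ × List (List (List (ℕ × ℕ)))

namespace AutomatonCode

def numStates (c : AutomatonCode) : ℕ := c.1
def numLetters (c : AutomatonCode) : ℕ := c.2.1
def initState (c : AutomatonCode) : ℕ := c.2.2.1
def acceptList (c : AutomatonCode) : List ℕ := c.2.2.2.1
def table (c : AutomatonCode) : List (List (List (ℕ × ℕ))) := c.2.2.2.2

/-- The numerator and denominator at `a`, `q`, `q'` (missing entries of the table are read as
`0 / 1`). -/
def fraction (c : AutomatonCode) (a q q' : ℕ) : ℕ × ℕ :=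
  ((c.table.getD a []).getD q []).getD q' (0, 1)

/-- The transition probability described at `a`, `q`, `q'`. -/
def entry (c : AutomatonCode) (a q q' : ℕ) : ℚ :=
  ((c.fraction a q q').1 : ℚ) / ((c.fraction a q q').2 : ℚ)

/-- The description is that of an automaton: the initial state is a state, the alphabet is not
empty, denominators do not vanish and the rows of the matrices sum to one. -/
structure WellFormed (c : AutomatonCode) : Prop where
  init_lt : c.initState < c.numStates
  letters_pos : 0 < c.numLetters
  den_pos : ∀ a < c.numLetters, ∀ q < c.numStates, ∀ q' < c.numStates, 0 < (c.fraction a q q').2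
  row_sum : ∀ a < c.numLetters, ∀ q < c.numStates,
    ∑ q' ∈ Finset.range c.numStates, c.entry a q q' = 1

/-- The automaton described by a well-formed description. -/
def toAutomaton (c : AutomatonCode) (hc : c.WellFormed) :
    ProbAutomaton (Fin c.numStates) (Fin c.numLetters) where
  init := ⟨c.initState, hc.init_lt⟩
  trans a q q' := (c.entry a q q' : ℝ)
  trans_nonneg a q q' := by
    have h : 0 ≤ c.entry a q q' := by unfold entry; positivity
    exact_mod_cast h
  trans_sum a q := by
    have h := hc.row_sum a a.2 q q.2
    rw [← Fin.sum_univ_eq_sum_range (fun q' => c.entry a q q') c.numStates] at h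
    exact_mod_cast h

/-- The set of accepting states given by a description. -/
def accepting (c : AutomatonCode) : Set (Fin c.numStates) := {q | (q : ℕ) ∈ c.acceptList}

end AutomatonCode

/-- A property of (or a question about) automata with finite state sets `Fin n`, finite alphabets
`Fin m` and sets of accepting states. -/
abbrev AutomatonProperty : Type :=
  ∀ n m : ℕ, ProbAutomaton (Fin n) (Fin m) → Set (Fin n) → Prop

/-- The question is undecidable for the class of automata: no algorithm, given the description of an
automaton of the class, decides whether the answer is yes. Nothing is asked of the algorithm on
inputs that do not describe an automaton of the class. -/
def UndecidableFor (cls question : AutomatonProperty) : Prop :=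
  ¬ ∃ decider : AutomatonCode → Bool, Computable decider ∧
    ∀ (c : AutomatonCode) (hc : c.WellFormed),
      cls c.numStates c.numLetters (c.toAutomaton hc) c.accepting →
        (decider c = true ↔
          question c.numStates c.numLetters (c.toAutomaton hc) c.accepting)

end

/-! The halting problem is reduced to each question. A Turing machine is simulated by a queue
machine `δ` that removes the front symbol of a queue and appends a nonempty word. A word read by the
automaton claims which symbols are removed. In base `B`, the symbols ever queued (initial and
appended) and the claimed symbols form two numbers, whose difference is `gap`. If all claims are
right, the gap after `t` steps is the value of the current queue divided by `B ^ t`, which tends to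
0 along an endless run. Since the digits are small compared with `B`, a wrong claim leaves a gap
that no later claim can close (`defect_growth`).

A probabilistic automaton can account for the squared gap. The place values of the next appended and
the next removed digit are weights, both numbers are updated linearly, and the increment of the
squared difference is a product of two linear forms. It is therefore linear in the products of a
weight with a weight or number (`sum_change`). These products are the masses of the transient
states. They shrink with every letter, and the mass set free goes to two sinks in the proportion
`lam : 1 - lam`, corrected by `-κ` times the increment. The corrections telescope, so the acceptance
probability is the limit of `lam - κ * gap ^ 2`; a claimed run that halts at time `T` stops there
and is paid an extra `κ * σ / (B ^ (T + 1)) ^ 2` (`pays`).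

For `σ = 1 / 8` this bonus outweighs the squared gap of an honest halting run but not that of a
dishonest one, so some word exceeds `lam` iff the machine halts (`existence_iff_halts`); this
settles existence and value. For `σ = -1` halting is punished: an endless honest run yields exactly
`lam` (`exists_eq_of_not_halts`), whereas if the machine halts every word loses a fixed amount by
then (`exists_le_of_halts`); this settles equality and the `ε`-form.

All transient mass dies out, so avoiding the rejecting sink is as likely as reaching the accepting
one, and the same automata serve for safety and reachability. The machine is fixed and only the
initial queue varies, which affects only the transition row of the start state. -/

/-! ### State distributions and acceptance probabilities. -/

/-- The distribution of the state after `t` letters of `w`, for the matrices `M` and the initial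
state `i`. -/
def stateDist {R S T : Type} [Semiring R] [Fintype T] [DecidableEq T] (M : S → T → T → R) (i : T)
    (w : ℕ → S) : ℕ → T → R
  | 0 => Pi.single i 1
  | t + 1 => fun q' => ∑ q, stateDist M i w t q * M (w t) q q'

namespace ProbAutomaton

variable {Q S : Type} [Fintype Q] [DecidableEq Q] [MeasurableSpace Q] [MeasurableSingletonClass Q]

instance (A : ProbAutomaton Q S) (w : ℕ → S) : IsProbabilityMeasure (A.pathMeasure w) := by
  unfold pathMeasure; infer_instance

theorem stepKernel_singleton (A : ProbAutomaton Q S) (a : S) (q q' : Q) :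
    A.stepKernel a q {q'} = ENNReal.ofReal (A.trans a q q') := by
  change (∑ r, ENNReal.ofReal (A.trans a q r) • Measure.dirac r) {q'} = _
  rw [Measure.finsetSum_apply]
  simp [Set.indicator_apply]

/-- The joint law of the history up to `t` and the next state is a composition product, and its
kernel is constant on the histories that end in `q`. -/
theorem pathMeasure_step (A : ProbAutomaton Q S) (w : ℕ → S) (t : ℕ) (q q' : Q) :
    (A.pathMeasure w).real {π | π t = q ∧ π (t + 1) = q'} =
      (A.pathMeasure w).real {π | π t = q} * A.trans (w t) q q' := by
  have hm : MeasurableSet {x : (i : Finset.Iic t) → (fun _ : ℕ => Q) i |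
      x ⟨t, Finset.mem_Iic.2 le_rfl⟩ = q} :=
    measurableSet_eq_fun (measurable_pi_apply (⟨t, Finset.mem_Iic.2 le_rfl⟩ : Finset.Iic t))
      measurable_const
  have h := Kernel.partialTraj_compProd_eq_map_traj (X := fun _ : ℕ => Q)
    (κ := A.historyKernel w) (zero_le : 0 ≤ t) (x₀ := fun _ => A.init)
  have h1 : A.pathMeasure w {π | π t = q ∧ π (t + 1) = q'} =
      A.pathMeasure w {π | π t = q} * ENNReal.ofReal (A.trans (w t) q q') := by
    have h2 := congrArg (fun μ => μ ({x | x ⟨t, Finset.mem_Iic.2 le_rfl⟩ = q} ×ˢ {q'})) h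
    rw [Measure.map_apply (by fun_prop) (hm.prod (measurableSet_singleton q')),
      Measure.compProd_apply_prod hm (measurableSet_singleton q')] at h2
    have h3 : ∀ x ∈ {x : (i : Finset.Iic t) → (fun _ : ℕ => Q) i |
        x ⟨t, Finset.mem_Iic.2 le_rfl⟩ = q},
        A.historyKernel w t x {q'} = ENNReal.ofReal (A.trans (w t) q q') := by
      intro x hx
      rw [← A.stepKernel_singleton (w t) q q']
      unfold historyKernel
      rw [Kernel.comap_apply, hx]
    rw [setLIntegral_congr_fun hm h3, setLIntegral_const,
      ← Kernel.traj_map_frestrictLe_apply, Measure.map_apply (by fun_prop) hm] at h2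
    rw [mul_comm]
    exact h2.symm
  rw [measureReal_def, measureReal_def, h1, ENNReal.toReal_mul,
    ENNReal.toReal_ofReal (A.trans_nonneg _ _ _)]

theorem pathMeasure_eval (A : ProbAutomaton Q S) (w : ℕ → S) (t : ℕ) (q : Q) :
    (A.pathMeasure w).real {π | π t = q} = stateDist A.trans A.init w t q := by
  induction t generalizing q with
  | zero =>
    have h := Kernel.traj_map_frestrictLe_apply (X := fun _ : ℕ => Q)
      (κ := A.historyKernel w) 0 0 (fun _ => A.init)
    rw [Kernel.partialTraj_self, Kernel.id_apply] at h
    have hm : MeasurableSet {x : (i : Finset.Iic 0) → (fun _ : ℕ => Q) i |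
        x ⟨0, Finset.mem_Iic.2 le_rfl⟩ = q} :=
      measurableSet_eq_fun (measurable_pi_apply (⟨0, Finset.mem_Iic.2 le_rfl⟩ : Finset.Iic 0))
      measurable_const
    have h2 := congrArg (fun μ => μ {x | x ⟨0, Finset.mem_Iic.2 le_rfl⟩ = q}) h
    rw [Measure.map_apply (by fun_prop) hm, Measure.dirac_apply' _ hm] at h2
    have h3 : (A.pathMeasure w) {π | π 0 = q} = _ := h2
    rw [measureReal_def, h3]
    by_cases hq : A.init = q
    · subst hq; simp [stateDist]
    · simp [stateDist, hq, Ne.symm hq]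
  | succ t ih =>
    have hU : {π : ℕ → Q | π (t + 1) = q} = ⋃ r, {π : ℕ → Q | π t = r ∧ π (t + 1) = q} := by
      ext π; simp
    rw [hU, measureReal_iUnion_fintype]
    · simp_rw [pathMeasure_step, ih]; rfl
    · intro r r' hr
      refine Set.disjoint_left.2 fun π h h' => hr (h.1.symm.trans h'.1)
    · intro r
      exact (measurableSet_eq_fun (measurable_pi_apply t) measurable_const).inter
        (measurableSet_eq_fun (measurable_pi_apply (t + 1)) measurable_const)

theorem ae_stay (A : ProbAutomaton Q S) {r : Q} (hr : A.IsAbsorbingState r) (w : ℕ → S) :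
    ∀ᵐ π ∂A.pathMeasure w, ∀ t, π t = r → π (t + 1) = r := by
  rw [ae_all_iff]
  intro t
  rw [ae_iff]
  have hsub : {π : ℕ → Q | ¬(π t = r → π (t + 1) = r)} ⊆
      ⋃ q ∈ (Finset.univ.erase r), {π : ℕ → Q | π t = r ∧ π (t + 1) = q} := by
    intro π hπ
    simp only [Set.mem_ofPred_eq, Classical.not_imp] at hπ
    simp [hπ.1, hπ.2]
  refine measure_mono_null hsub ((measure_biUnion_null_iff (Finset.countable_toSet _)).2 ?_)
  intro q hq
  have hz : A.trans (w t) r q = 0 := by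
    have h1 := A.trans_sum (w t) r
    rw [← Finset.add_sum_erase _ _ (Finset.mem_univ r), hr (w t)] at h1
    exact (Finset.sum_eq_zero_iff_of_nonneg fun q' _ => A.trans_nonneg (w t) r q').1
      (by linarith) q hq
  have h := A.pathMeasure_step w t r q
  rw [hz, mul_zero] at h
  exact (measureReal_eq_zero_iff).1 h

/-- As `r` is absorbing, having visited `r` by time `t` is almost surely the same as being in `r` at
time `t`; then continuity from below applies. -/
theorem tendsto_acceptProb_reach (A : ProbAutomaton Q S) {r : Q} (hr : A.IsAbsorbingState r)
    (w : ℕ → S) :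
    Filter.Tendsto (fun t => stateDist A.trans A.init w t r) Filter.atTop
      (nhds (A.acceptProb (Reach {r}) w)) := by
  set E : ℕ → Set (ℕ → Q) := fun t => {π | ∃ i ≤ t, π i = r}
  have hmono : Monotone E := fun s t hst π ⟨i, hi, h⟩ => ⟨i, hi.trans hst, h⟩
  have hun : Reach {r} = ⋃ t, E t := by
    ext π
    simp only [Reach, Set.mem_ofPred_eq, Set.mem_singleton_iff, Set.mem_iUnion, E]
    exact ⟨fun ⟨i, h⟩ => ⟨i, i, le_rfl, h⟩, fun ⟨_, i, _, h⟩ => ⟨i, h⟩⟩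
  have h1 := tendsto_measure_iUnion_atTop (μ := A.pathMeasure w) hmono
  rw [← hun] at h1
  have h2 := (ENNReal.tendsto_toReal (measure_ne_top (A.pathMeasure w) (Reach {r}))).comp h1
  refine h2.congr fun t => ?_
  rw [← pathMeasure_eval]
  refine congrArg ENNReal.toReal (measure_congr ?_)
  filter_upwards [A.ae_stay hr w] with π hπ
  refine propext ⟨fun ⟨i, hi, h⟩ => ?_, fun h => ⟨t, le_rfl, h⟩⟩
  exact Nat.le_induction (m := i) (P := fun n _ => π n = r) h (fun n _ hn => hπ n hn) t hi

omit [DecidableEq Q] in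
theorem acceptProb_safe_compl (A : ProbAutomaton Q S) (r : Q) (w : ℕ → S) :
    A.acceptProb (Safe {r}ᶜ) w = 1 - A.acceptProb (Reach {r}) w := by
  have h : Safe {r}ᶜ = (Reach {r} : Set (ℕ → Q))ᶜ := by
    ext π; simp [Safe, Reach]
  have hm : MeasurableSet (Reach {r} : Set (ℕ → Q)) := by
    have : (Reach {r} : Set (ℕ → Q)) = ⋃ i, {π | π i = r} := by
      ext π; simp [Reach]
    rw [this]
    exact MeasurableSet.iUnion fun i =>
      measurableSet_eq_fun (measurable_pi_apply i) measurable_const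
  unfold acceptProb
  rw [h, probReal_compl_eq_one_sub hm]

end ProbAutomaton

/-! ### Queue machines and padding. -/

namespace QueueMachine

open StateTransition Relation

/-- One step of the deterministic queue machine with transition function `δ`: it removes the front
symbol of the queue and appends a word to its end. On the empty queue it idles. -/
def step {C S : Type} (δ : C → S → Option (C × List S)) : C × List S → Option (C × List S)
  | (c, []) => some (c, [])
  | (c, a :: l) => (δ c a).map fun r => (r.1, l ++ r.2)

/-- The queue machine that appends and skips a padding symbol `none`, so that every step appends
at least one symbol. -/
def pad {C S : Type} (δ : C → S → Option (C × List S)) :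
    C → Option S → Option (C × List (Option S))
  | c, none => some (c, [none])
  | c, some a => (δ c a).map fun r => (r.1, if r.2 = [] then [none] else r.2.map some)

variable {C S : Type} {δ : C → S → Option (C × List S)}

theorem pad_ne_nil {c c' : C} {a : Option S} {e : List (Option S)}
    (h : pad δ c a = some (c', e)) : e ≠ [] := by
  cases a with
  | none => simp only [pad, Option.some.injEq, Prod.mk.injEq] at h; simp [← h.2]
  | some a =>
    simp only [pad, Option.map_eq_some_iff, Prod.mk.injEq] at h
    obtain ⟨r, -, -, rfl⟩ := h
    split_ifs with hr <;> simp [hr]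

theorem reduceOption_map_some (e : List S) : (e.map some).reduceOption = e := by
  induction e with
  | nil => rfl
  | cons a e ih => simp [ih]

theorem reduceOption_pad (e : List S) :
    (if e = [] then [none] else e.map some : List (Option S)).reduceOption = e := by
  split_ifs with h
  · simp [h]
  · exact reduceOption_map_some e

/-- Leading padding is rotated to the end until a genuine symbol is in front. The suffix `u` is
arbitrary because it collects the rotated padding during the induction on `l`. -/
theorem reaches_skip (c : C) (l : List (Option S)) : ∀ u : List (Option S), l.reduceOption ≠ [] →
    ∃ a t, (some a :: t : List (Option S)).reduceOption = l.reduceOption ++ u.reduceOption ∧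
      Reaches (step (pad δ)) (c, l ++ u) (c, some a :: t) := by
  induction l with
  | nil => intro u h; simp at h
  | cons x l ih =>
    intro u h
    cases x with
    | none =>
      rw [List.reduceOption_cons_of_none] at h ⊢
      obtain ⟨a, t, h1, h2⟩ := ih (u ++ [none]) h
      refine ⟨a, t, ?_, ReflTransGen.head (b := (c, l ++ (u ++ [none]))) ?_ h2⟩
      · rw [h1, List.reduceOption_append]; simp
      · simp [step, pad]
    | some a => exact ⟨a, l ++ u, by simp [List.reduceOption_append], ReflTransGen.refl⟩

/-- A padded queue `l'` represents the queue `l` if it is nonempty, its symbols are those of `l`,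
and it does not start with padding unless `l` is empty. -/
def PadRel (x : C × List S) (y : C × List (Option S)) : Prop :=
  x.1 = y.1 ∧ y.2.reduceOption = x.2 ∧
    ((x.2 = [] ∧ y.2 ≠ []) ∨ ∃ a t, y.2 = some a :: t)

theorem respects_pad (δ : C → S → Option (C × List S)) :
    Respects (step δ) (step (pad δ)) PadRel := by
  rintro ⟨c, l⟩ ⟨c', l'⟩ ⟨h1, h2, h3⟩
  dsimp only at h1 h2 h3
  subst h1
  rcases h3 with ⟨rfl, h3⟩ | ⟨a, t, rfl⟩
  · obtain ⟨x, t, rfl⟩ := List.exists_cons_of_ne_nil h3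
    cases x with
    | some a => simp at h2
    | none =>
      -- On the empty queue the original machine idles forever; the padded one matches this by
      -- rotating its padding.
      refine ⟨(c, t ++ [none]), ⟨rfl, ?_, Or.inl ⟨rfl, by simp⟩⟩, TransGen.single ?_⟩
      · simpa [List.reduceOption_append] using h2
      · simp [step, pad]
  · rw [List.reduceOption_cons_of_some] at h2
    subst h2
    cases hδ : δ c a with
    | none => simp [step, pad, hδ]
    | some r =>
      obtain ⟨c', e⟩ := r
      simp only [step, hδ, Option.map_some]
      set e' : List (Option S) := if e = [] then [none] else e.map some with he'
      have hr : (t ++ e').reduceOption = t.reduceOption ++ e := by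
        rw [List.reduceOption_append, he', reduceOption_pad]
      have hs : step (pad δ) (c, some a :: t) = some (c', t ++ e') := by
        simp [step, pad, hδ, he']
      by_cases hn : t.reduceOption ++ e = []
      · refine ⟨(c', t ++ e'), ⟨rfl, hr, Or.inl ⟨hn, ?_⟩⟩, TransGen.single hs⟩
        intro h
        have h0 := (List.append_eq_nil_iff.1 h).2
        rw [he'] at h0
        split_ifs at h0 with h4
        exact h4 (List.map_eq_nil_iff.1 h0)
      · obtain ⟨b, u, h4, h5⟩ := reaches_skip (δ := δ) c' (t ++ e') [] (by rwa [hr])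
        rw [List.append_nil] at h5
        refine ⟨(c', some b :: u), ⟨rfl, ?_, Or.inr ⟨b, u, rfl⟩⟩, TransGen.head' hs h5⟩
        rw [h4, hr]; simp

end QueueMachine

/-! ### Simulation of a Turing machine by a queue machine. -/

namespace TMQueue

open Turing StateTransition Relation QueueMachine

variable {Γ Λ : Type} [Inhabited Γ] [Inhabited Λ]

/-- Queue symbols: tape symbols, the end mark `inr false` and the rotation mark `inr true`. -/
abbrev Sym (Γ : Type) : Type := Γ ⊕ Bool

/-- Control states: `inl (inl (q, h))` when the machine is in state `q` with the symbol `h` under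
its head, `inl (inr (q, h))` while the queue is rotated back before continuing there, and
`inr (q, y)` while the queue is rotated with the symbol `y` held back. -/
abbrev Ctrl (Γ Λ : Type) : Type := (Λ × Γ ⊕ Λ × Γ) ⊕ Λ × Sym Γ

/-- The queue machine simulating a Turing machine. -/
def trans (M : TM0.Machine Γ Λ) : Ctrl Γ Λ → Sym Γ → Option (Ctrl Γ Λ × List (Sym Γ))
  | .inl (.inl (q, h)), x =>
    match M q h with
    | none => none
    | some (q', .write b) => some (.inl (.inr (q', b)), [.inr true, x])
    | some (q', .move .right) =>
      match x with
      | .inl a => some (.inl (.inl (q', a)), [.inl h])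
      -- The right end of the tape is reached: the new head symbol is blank. The end mark belongs in
      -- front of the left half of the tape, so it is appended behind a rotation mark and everything
      -- before that mark is rotated.
      | .inr _ => some (.inl (.inr (q', default)), [.inl h, .inr true, .inr false])
    -- The symbol left of the head is the last one in the queue, out of direct reach. A rotation
    -- that lags one symbol behind holds exactly this symbol when the mark comes up.
    | some (q', .move .left) => some (.inr (q', x), [.inr true, .inl h])
  | .inl (.inr (q, h)), x =>
    match x with
    | .inr true => some (.inl (.inl (q, h)), [])
    | x => some (.inl (.inr (q, h)), [x])
  | .inr (q, y), x =>
    match x with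
    | .inr true =>
      match y with
      | .inl a => some (.inl (.inl (q, a)), [])
      | .inr b => some (.inl (.inl (q, default)), [.inr b])
    | x => some (.inr (q, x), [y])

theorem reaches_rotate (M : TM0.Machine Γ Λ) (q : Λ) (h : Γ) (u : List (Sym Γ)) :
    ∀ v : List (Sym Γ), .inr true ∉ u →
      Reaches (step (trans M)) (.inl (.inr (q, h)), u ++ .inr true :: v)
        (.inl (.inl (q, h)), v ++ u) := by
  induction u with
  | nil => intro v _; exact ReflTransGen.single (by simp [step, trans])
  | cons x u ih =>
    intro v hu
    simp only [List.mem_cons, not_or] at hu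
    have h1 := ih (v ++ [x]) hu.2
    rw [List.append_assoc] at h1
    refine ReflTransGen.head ?_ h1
    rcases x with a | _ | _
    · simp [step, trans]
    · simp [step, trans]
    · exact absurd rfl hu.1

theorem reaches_delayed (M : TM0.Machine Γ Λ) (q : Λ) (u : List (Sym Γ)) :
    ∀ (y z : Sym Γ) (v u' : List (Sym Γ)), .inr true ∉ u → y :: u = u' ++ [z] →
      Reaches (step (trans M)) (.inr (q, y), u ++ .inr true :: v)
        (.inr (q, z), .inr true :: v ++ u') := by
  induction u with
  | nil =>
    intro y z v u' _ h
    have h1 : u' = [] := by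
      have := congrArg List.length h
      simpa using this
    subst h1
    simp only [List.nil_append, List.cons.injEq, and_true] at h
    subst h
    simp only [List.nil_append, List.append_nil]
    exact ReflTransGen.refl
  | cons x u ih =>
    intro y z v u' hu h
    simp only [List.mem_cons, not_or] at hu
    obtain ⟨u'', rfl, h2⟩ : ∃ u'', u' = y :: u'' ∧ x :: u = u'' ++ [z] := by
      cases u' with
      | nil => simp at h
      | cons y' u'' =>
        simp only [List.cons_append, List.cons.injEq] at h
        exact ⟨u'', by rw [h.1], h.2⟩
    have h1 := ih x z (v ++ [y]) u'' hu.2 h2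
    simp only [List.cons_append, List.append_assoc, List.nil_append] at h1 ⊢
    refine ReflTransGen.head ?_ h1
    rcases x with a | _ | _
    · simp [step, trans]
    · simp [step, trans]
    · exact absurd rfl hu.1

/-- The queue machine configurations that represent a configuration of the Turing machine. -/
def Rel (x : TM0.Cfg Γ Λ) (y : Ctrl Γ Λ × List (Sym Γ)) : Prop :=
  ∃ (L R : List Γ) (h : Γ), x.Tape = Tape.mk' (ListBlank.mk L) (ListBlank.mk (h :: R)) ∧
    y = (.inl (.inl (x.q, h)), R.map .inl ++ .inr false :: L.reverse.map .inl)

theorem mk_default_nil : (ListBlank.mk [default] : ListBlank Γ) = ListBlank.mk [] :=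
  Quotient.sound' (Or.inr ⟨1, rfl⟩)

/-- The queue is the tape read cyclically from the cell right of the head: the right half, the end
mark, then the left half from its far end. Each tape step is at most one full rotation of this
cycle. -/
theorem respects (M : TM0.Machine Γ Λ) : Respects (TM0.step M) (step (trans M)) Rel := by
  rintro ⟨q, T⟩ _ ⟨L, R, h, hT, rfl⟩
  dsimp only at hT ⊢
  subst hT
  obtain ⟨x, t, hx⟩ : ∃ x t, R.map (Sum.inl : Γ → Sym Γ) ++ .inr false :: L.reverse.map .inl
      = x :: t := List.exists_cons_of_ne_nil (by simp)
  have hm : (.inr true : Sym Γ) ∉ x :: t := by rw [← hx]; simp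
  have hm' : (.inr true : Sym Γ) ∉ t := fun h => hm (List.mem_cons_of_mem _ h)
  simp only [TM0.step, Tape.mk'_head, ListBlank.head_mk, List.headI_cons]
  cases hM : M q h with
  | none =>
    change step (trans M) _ = none
    rw [hx]
    simp [step, trans, hM]
  | some r =>
    obtain ⟨q', s⟩ := r
    simp only [Option.map_some]
    rcases s with d | b
    · cases d with
      | right =>
        cases R with
        | cons a R =>
          refine ⟨_, ⟨h :: L, R, a, ?_, rfl⟩, TransGen.single ?_⟩
          · simp [Tape.move_right_mk']
          · simp [step, trans, hM]
        | nil =>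
          refine ⟨_, ⟨h :: L, [], default, ?_, rfl⟩, TransGen.head'
            (b := (.inl (.inr (q', default)), (L.reverse ++ [h]).map .inl ++
              .inr true :: [.inr false])) ?_ ?_⟩
          · simp [Tape.move_right_mk', mk_default_nil]
          · simp [step, trans, hM]
          · have := reaches_rotate M q' default ((L.reverse ++ [h]).map Sum.inl) [.inr false]
              (by simp)
            simpa [Reaches] using this
      | left =>
        cases L with
        | cons a L =>
          have h1 := reaches_delayed M q' t x (.inl a) [.inl h]
            (R.map .inl ++ .inr false :: L.reverse.map .inl) hm' (by rw [← hx]; simp)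
          refine ⟨_, ⟨L, h :: R, a, ?_, rfl⟩, TransGen.head' ?_ (ReflTransGen.tail h1 ?_)⟩
          · simp [Tape.move_left_mk']
          · rw [hx]; simp [step, trans, hM]
          · simp [step, trans]
        | nil =>
          have h1 := reaches_delayed M q' t x (.inr false) [.inl h] (R.map .inl) hm'
            (by rw [← hx]; simp)
          refine ⟨_, ⟨[], h :: R, default, ?_, rfl⟩, TransGen.head' ?_ (ReflTransGen.tail h1 ?_)⟩
          · simp [Tape.move_left_mk']
          · rw [hx]; simp [step, trans, hM]
          · simp [step, trans]
    · refine ⟨_, ⟨L, R, b, ?_, rfl⟩, TransGen.head'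
        (b := (.inl (.inr (q', b)), t ++ .inr true :: [x])) ?_ ?_⟩
      · simp [Tape.write_mk']
      · rw [hx]; simp [step, trans, hM]
      · rw [hx]
        exact reaches_rotate M q' b t [x] hm'

end TMQueue

/-! ### Undecidable halting on inputs of a simple shape. -/

namespace TMQueue

open Turing StateTransition Relation

theorem primrec_two_pow : Primrec fun m : ℕ => 2 ^ m := by
  refine (Primrec.nat_rec' (f := fun m : ℕ => m) (g := fun _ => 1) (h := fun _ p => 2 * p.2)
    Primrec.id (Primrec.const 1) ?_).of_eq fun m => ?_
  · exact Primrec.nat_mul.comp (Primrec.const 2) (Primrec.snd.comp Primrec.snd)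
  · induction m with
    | zero => rfl
    | succ m ih => rw [pow_succ, ← ih, mul_comm]

/-- A partial recursive function whose domain, restricted to powers of two, is not decidable. -/
theorem exists_partrec_undecidable : ∃ f : ℕ →. ℕ, Partrec f ∧
    ∀ d : ℕ → Bool, Computable d → ¬ ∀ m, d m = true ↔ (f (2 ^ m)).Dom := by
  -- On input `2 ^ m` the search recovers the exponent, and `f` then runs the program with number
  -- `m`.
  let p : ℕ → ℕ →. Bool := fun k m => Part.some (decide (2 ^ m = k))
  let f : ℕ →. ℕ := fun k =>
    (Nat.rfind (p k)).bind fun m => (Denumerable.ofNat Nat.Partrec.Code m).eval 0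
  have hp : Partrec₂ p := by
    have h : Primrec fun x : ℕ × ℕ => decide (2 ^ x.2 = x.1) :=
      (Primrec.eq.comp (primrec_two_pow.comp Primrec.snd) Primrec.fst).decide
    exact h.to_comp.partrec
  have hf : Partrec f := by
    refine (Partrec.rfind hp).bind ?_
    exact Nat.Partrec.Code.eval_part.comp ((Computable.ofNat _).comp Computable.snd)
      (Computable.const 0)
  refine ⟨f, hf, fun d hd h => ComputablePred.halting_problem 0 ?_⟩
  rw [ComputablePred.computable_iff]
  refine ⟨fun c => d (Encodable.encode c), hd.comp Computable.encode, ?_⟩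
  funext c
  rw [h, eq_iff_iff]
  have hr : Nat.rfind (p (2 ^ Encodable.encode c)) = Part.some (Encodable.encode c) := by
    refine Part.eq_some_iff.2 (Nat.mem_rfind.2 ⟨by simp [p], fun {m} hm => ?_⟩)
    simpa [p] using hm.ne
  simp only [f, hr, Part.bind_some, Denumerable.ofNat_encode]

/-- The reason for using powers of two: their binary expansions give a family of tapes in which only
the number of repetitions of one symbol varies. -/
theorem trNat_two_pow (m : ℕ) : PartrecToTM2.trNat (2 ^ m) =
    List.replicate m PartrecToTM2.Γ'.bit0 ++ [PartrecToTM2.Γ'.bit1] := by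
  have h : ∀ m : ℕ, ∃ p : PosNum, ((2 ^ m : ℕ) : Num) = Num.pos p ∧ PartrecToTM2.trPosNum p =
      List.replicate m PartrecToTM2.Γ'.bit0 ++ [PartrecToTM2.Γ'.bit1] := by
    intro m
    induction m with
    | zero => exact ⟨PosNum.one, rfl, rfl⟩
    | succ m ih =>
      obtain ⟨p, h1, h2⟩ := ih
      refine ⟨p.bit0, ?_, ?_⟩
      · rw [pow_succ, mul_two, Nat.cast_add, h1, Num.bit0_of_bit0]; rfl
      · rw [PartrecToTM2.trPosNum, h2]; rfl
  obtain ⟨p, h1, h2⟩ := h m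
  rw [PartrecToTM2.trNat, h1, PartrecToTM2.trNum, h2]

instance : Finite PartrecToTM2.K' :=
  Finite.of_surjective (fun n : Fin 4 => match n with
    | 0 => PartrecToTM2.K'.main
    | 1 => .rev
    | 2 => .aux
    | 3 => .stack) fun
    | .main => ⟨0, rfl⟩
    | .rev => ⟨1, rfl⟩
    | .aux => ⟨2, rfl⟩
    | .stack => ⟨3, rfl⟩

/-- The translations from partial recursive code through multi-stack and one-tape machines preserve
the domain. Their state type is infinite but only a finite supported set is ever visited, so the
machine can be restricted to it. -/
theorem exists_undecidable_TM0 : ∃ (Γ Λ : Type) (_ : Finite Γ) (_ : Finite Λ) (_ : Inhabited Γ)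
    (_ : Inhabited Λ) (M : TM0.Machine Γ Λ) (a b c : Γ),
    ∀ d : ℕ → Bool, Computable d →
      ¬ ∀ m, d m = true ↔ (TM0.eval M (a :: b :: List.replicate m c)).Dom := by
  classical
  obtain ⟨f, hf, hund⟩ := exists_partrec_undecidable
  obtain ⟨code, hcode⟩ := ToPartrec.Code.exists_code (Nat.Partrec'.part_iff₁.2 hf)
  let : Inhabited PartrecToTM2.Λ' := ⟨PartrecToTM2.trNormal code .halt⟩
  let M1 := TM2to1.tr PartrecToTM2.tr
  let M0 := TM1to0.tr M1
  let Γ₀ := TM2to1.Γ' PartrecToTM2.K' (fun _ => PartrecToTM2.Γ')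
  have hfin : Finite Γ₀ := by
    change Finite (Bool × (PartrecToTM2.K' → Option PartrecToTM2.Γ'))
    infer_instance
  have ss2 := PartrecToTM2.tr_supports code .halt
  have ss1 := TM2to1.tr_supports PartrecToTM2.tr ss2
  have ss0 := TM1to0.tr_supports M1 ss1
  set F := TM1to0.trStmts M1 (TM2to1.trSupp PartrecToTM2.tr (PartrecToTM2.codeSupp code .halt))
  let Λ₀ := {q // q ∈ F}
  let : Inhabited Λ₀ := ⟨⟨default, ss0.1⟩⟩
  let g : PointedMap (TM1to0.Λ' M1) Λ₀ :=
    ⟨fun q => if h : q ∈ F then ⟨q, h⟩ else default, by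
      have h : (default : TM1to0.Λ' M1) ∈ F := ss0.1
      rw [dif_pos h]; rfl⟩
  let i : PointedMap Γ₀ Γ₀ := ⟨id, rfl⟩
  let M := TM0.Machine.map M0 i i g.f (fun q : Λ₀ => q.1)
  have hresp := TM0.Machine.map_respects M0 i i g (fun q : Λ₀ => q.1) ss0 (fun _ => rfl)
    (fun q hq => by
      have h : q ∈ F := hq
      simp only [g, dif_pos h])
  have key : ∀ v : List ℕ, (TM0.eval M (TM2to1.trInit PartrecToTM2.K'.main
      (PartrecToTM2.trList v))).Dom ↔ (code.eval v).Dom := by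
    intro v
    have h1 := tr_eval_dom hresp (a₁ := TM0.init (TM2to1.trInit PartrecToTM2.K'.main
      (PartrecToTM2.trList v))) ⟨ss0.1, rfl⟩
    rw [TM0.map_init] at h1
    have h2 := TM2to1.tr_eval_dom PartrecToTM2.tr PartrecToTM2.K'.main (PartrecToTM2.trList v)
    rw [← TM1to0.tr_eval] at h2
    have h3 : (TM2.eval PartrecToTM2.tr PartrecToTM2.K'.main (PartrecToTM2.trList v)).Dom ↔
        (StateTransition.eval (TM2.step PartrecToTM2.tr) (PartrecToTM2.init code v)).Dom := by
      have h4 : (TM2.init PartrecToTM2.K'.main (PartrecToTM2.trList v) :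
          TM2.Cfg (fun _ => PartrecToTM2.Γ') PartrecToTM2.Λ' (Option PartrecToTM2.Γ')) =
          PartrecToTM2.init code v := by
        unfold TM2.init PartrecToTM2.init
        congr 1
        funext k
        cases k <;> rfl
      rw [← h4]; rfl
    rw [PartrecToTM2.tr_eval] at h3
    have h5 : List.map i.f (TM2to1.trInit PartrecToTM2.K'.main (PartrecToTM2.trList v)) =
        TM2to1.trInit PartrecToTM2.K'.main (PartrecToTM2.trList v) := List.map_id _
    rw [h5] at h1
    exact (h1.trans h2).trans h3
  let s : PartrecToTM2.Γ' → Γ₀ := fun x =>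
    (false, Function.update (fun _ => none) PartrecToTM2.K'.main (some x))
  -- The stack is written in reverse, so the separator comes first, then the leading bit. The flag
  -- `true` marks the bottom of the stacks and occurs only in the first cell.
  refine ⟨Γ₀, Λ₀, hfin, inferInstance, inferInstance, inferInstance, M, (true, (s .cons).2),
    s .bit1, s .bit0, fun d hd h => hund d hd fun m => ?_⟩
  have h1 := hcode ⟨[2 ^ m], rfl⟩
  have h2 : TM2to1.trInit PartrecToTM2.K'.main (PartrecToTM2.trList [2 ^ m]) =
      (true, (s .cons).2) :: s .bit1 :: List.replicate m (s .bit0) := by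
    have hl : (PartrecToTM2.trList [2 ^ m]).reverse =
        .cons :: .bit1 :: List.replicate m PartrecToTM2.Γ'.bit0 := by
      simp [PartrecToTM2.trList, trNat_two_pow]
    unfold TM2to1.trInit
    rw [hl, ← List.map_replicate]
    rfl
  have h3 := key [2 ^ m]
  rw [h2] at h3
  refine (h m).trans (h3.trans ?_)
  rw [show code.eval [2 ^ m] = _ from h1]
  rfl

/-- There are a deterministic queue machine that appends a symbol in every step, a start state and
symbols such that halting on the queues `b, c, …, c, e` is not decidable. -/
theorem exists_undecidable_queueMachine : ∃ (C S : Type) (_ : Finite C) (_ : Finite S)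
    (δ : C → S → Option (C × List S)) (c₀ : C) (b c e : S),
    (∀ x a y l, δ x a = some (y, l) → l ≠ []) ∧
    ∀ d : ℕ → Bool, Computable d →
      ¬ ∀ m, d m = true ↔ ∃ y, Reaches (QueueMachine.step δ) (c₀, b :: List.replicate m c ++ [e]) y ∧
        QueueMachine.step δ y = none := by
  obtain ⟨Γ, Λ, _, _, _, _, M, a, b, c, h⟩ := exists_undecidable_TM0
  refine ⟨Ctrl Γ Λ, Option (Sym Γ), inferInstance, inferInstance, QueueMachine.pad (trans M),
    .inl (.inl (default, a)), some (.inl b), some (.inl c), some (.inr false),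
    fun x a y l => QueueMachine.pad_ne_nil, fun d hd hm => h d hd fun m => (hm m).trans ?_⟩
  have h1 := tr_eval_dom (respects M) (a₁ := TM0.init (a :: b :: List.replicate m c))
    ⟨[], b :: List.replicate m c, a, rfl, rfl⟩
  have h2 := tr_eval_dom (QueueMachine.respects_pad (trans M))
    (a₁ := (.inl (.inl (default, a)), (b :: List.replicate m c).map .inl ++ [.inr false]))
    (a₂ := (.inl (.inl (default, a)),
      ((b :: List.replicate m c).map Sum.inl ++ [Sum.inr false] : List (Sym Γ)).map some))
    ⟨rfl, QueueMachine.reduceOption_map_some _, Or.inr ⟨_, _, rfl⟩⟩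
  refine Iff.trans ?_ (h2.trans h1)
  rw [Part.dom_iff_mem]
  simp only [mem_eval, List.map_cons, List.map_append, List.map_replicate, List.map_nil]

end TMQueue

/-! ### Claimed runs, their defects and the payoffs. -/

namespace QueueMachine

open StateTransition Relation Filter Topology

variable {C S : Type} (δ : C → S → Option (C × List S)) (dig : S → ℕ) (B : ℕ)

/-- The number with the base `B` expansion `0.d₁d₂…` given by the digits of a word. -/
def val : List S → ℚ
  | [] => 0
  | a :: l => (dig a + val l) / B

/-- The digit of the front symbol of a queue. -/
def front : List S → ℕ
  | [] => 0
  | a :: _ => dig a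

/-- The run of the queue machine in which the symbols read are those claimed by the word `w`. The
integer component is the defect of the claims: the claimed symbols minus the removed ones,
as a base `B` number. -/
def follow (x : C × List S) (w : ℕ → S) : ℕ → Option (C × List S × ℤ)
  | 0 => some (x.1, x.2, 0)
  | t + 1 => (follow x w t).bind fun y => (δ y.1 (w t)).map fun r =>
      (r.1, y.2.1.tail ++ r.2, B * y.2.2 + front dig y.2.1 - dig (w t))

/-- The scaled defect including the part of the queue not yet removed. -/
def gap (x : C × List S) (w : ℕ → S) (t : ℕ) : ℚ :=
  match follow δ dig B x w t with
  | some (_, Q, N) => (N + val dig B Q) / B ^ t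
  | none => 0

/-- `P` is the payoff that punishes the limit of the squared gap or, if the machine halts, the
squared gap at this time, and pays `σ` for halting. -/
def Pays (lam κ σ : ℚ) (x : C × List S) (P : (ℕ → S) → ℝ) : Prop :=
  ∀ w, (∀ T c Q N, follow δ dig B x w T = some (c, Q, N) → δ c (w T) = none →
      P w = ((lam + κ * (σ - (((B * N + front dig Q - dig (w T) : ℤ) : ℚ) + val dig B Q.tail) ^ 2) /
        (B ^ (T + 1)) ^ 2 : ℚ) : ℝ)) ∧
    ((∀ t, follow δ dig B x w t ≠ none) →
      Tendsto (fun t => ((lam - κ * gap δ dig B x w t ^ 2 : ℚ) : ℝ)) atTop (𝓝 (P w)))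

/-- The machine halts when started in the configuration `x`. -/
def Halts (x : C × List S) : Prop := ∃ y, Reaches (step δ) x y ∧ step δ y = none

/-- The configuration after `t` steps. -/
def runFor (x : C × List S) : ℕ → Option (C × List S)
  | 0 => some x
  | t + 1 => (runFor x t).bind (step δ)

variable {δ dig B}

theorem reaches_iff_runFor {x y : C × List S} :
    Reaches (step δ) x y ↔ ∃ t, runFor δ x t = some y := by
  constructor
  · intro h
    induction h with
    | refl => exact ⟨0, rfl⟩
    | tail _ h ih =>
      obtain ⟨t, ht⟩ := ih
      exact ⟨t + 1, by rw [runFor, ht]; exact h⟩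
  · rintro ⟨t, ht⟩
    induction t generalizing y with
    | zero => cases ht; exact ReflTransGen.refl
    | succ t ih =>
      rw [runFor, Option.bind_eq_some_iff] at ht
      obtain ⟨z, hz, h⟩ := ht
      exact ReflTransGen.tail (ih hz) h

theorem halts_iff_runFor {x : C × List S} : Halts δ x ↔ ∃ t, runFor δ x t = none := by
  constructor
  · rintro ⟨y, hy, h⟩
    obtain ⟨t, ht⟩ := reaches_iff_runFor.1 hy
    exact ⟨t + 1, by rw [runFor, ht]; exact h⟩
  · rintro ⟨t, ht⟩
    induction t with
    | zero => cases ht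
    | succ t ih =>
      cases h : runFor δ x t with
      | none => exact ih h
      | some y =>
        rw [runFor, h] at ht
        exact ⟨y, reaches_iff_runFor.2 ⟨t, h⟩, ht⟩

theorem runFor_antitone {x : C × List S} {s t : ℕ} (hst : s ≤ t) (h : runFor δ x s = none) :
    runFor δ x t = none := by
  induction t, hst using Nat.le_induction with
  | base => exact h
  | succ t _ ih => rw [runFor, ih]; rfl

section Val

theorem val_append (hB : 0 < B) (l e : List S) :
    val dig B (l ++ e) = val dig B l + val dig B e / B ^ l.length := by
  have hB' : (B : ℚ) ≠ 0 := by positivity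
  induction l with
  | nil => simp [val]
  | cons a l ih =>
    rw [List.cons_append, val, ih, val, List.length_cons, pow_succ]
    field_simp
    ring

theorem val_nonneg (l : List S) : 0 ≤ val dig B l := by
  induction l with
  | nil => exact le_rfl
  | cons a l ih => rw [val]; positivity

variable {D : ℕ} (hD : ∀ a, dig a < D) (hB : 4 * D + 8 ≤ B)
include hD hB

theorem val_le (l : List S) : val dig B l ≤ 1 / 4 := by
  have hB' : (4 : ℚ) * D + 8 ≤ B := by exact_mod_cast hB
  have hD0 : (0 : ℚ) ≤ D := Nat.cast_nonneg _
  induction l with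
  | nil => norm_num [val]
  | cons a l ih =>
    have h : (dig a : ℚ) ≤ D := by exact_mod_cast (hD a).le
    rw [val, div_le_iff₀ (by linarith)]
    linarith

omit hB in
theorem front_le (hS : 0 < D) (l : List S) : front dig l < D := by
  cases l with
  | nil => exact hS
  | cons a l => exact hD a

omit hB in
theorem defect_step {N : ℤ} (l : List S) (a : S) :
    (B : ℚ) * |(N : ℚ)| - D ≤ |((B * N + front dig l - dig a : ℤ) : ℚ)| := by
  have h1 : (front dig l : ℚ) ≤ D := by
    exact_mod_cast (front_le hD (Nat.zero_lt_of_lt (hD a)) l).le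
  have h2 : (dig a : ℚ) ≤ D := by exact_mod_cast (hD a).le
  have h3 : |(front dig l : ℚ) - dig a| ≤ D := by
    rw [abs_le]
    constructor <;> linarith [Nat.cast_nonneg (α := ℚ) (front dig l),
      Nat.cast_nonneg (α := ℚ) (dig a)]
  have h4 : (((B * N + front dig l - dig a : ℤ) : ℚ)) = B * N + (front dig l - dig a) := by
    push_cast; ring
  have h5 := abs_sub_abs_le_abs_sub ((B : ℚ) * N) (-((front dig l : ℚ) - dig a))
  rw [abs_neg, sub_neg_eq_add, abs_mul, Nat.abs_cast] at h5
  rw [h4]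
  linarith

/-- The summand `1 / 4` in the hypothesis is room for the value of the queue, which is at most `1 /
4`. -/
theorem abs_add_val {N : ℤ} {k : ℕ} (h : (3 / 4 : ℚ) * B ^ k + 1 / 4 ≤ |(N : ℚ)|) (l : List S) :
    (9 / 16 : ℚ) * (B ^ k) ^ 2 ≤ (N + val dig B l) ^ 2 := by
  have h1 := val_le hD hB l
  have h2 := val_nonneg (dig := dig) (B := B) l
  have h3 : (3 / 4 : ℚ) * B ^ k ≤ |(N : ℚ) + val dig B l| := by
    have h5 := abs_sub_abs_le_abs_sub (N : ℚ) (-(val dig B l))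
    rw [abs_neg, sub_neg_eq_add, abs_of_nonneg h2] at h5
    linarith
  have h4 : (0 : ℚ) ≤ (3 / 4 : ℚ) * B ^ k := by positivity
  have := pow_le_pow_left₀ h4 h3 2
  rw [sq_abs] at this
  linarith [mul_pow (3 / 4 : ℚ) ((B : ℚ) ^ k) 2]

omit hD hB in
theorem one_le_abs {N : ℤ} (h : N ≠ 0) : (3 / 4 : ℚ) * B ^ 0 + 1 / 4 ≤ |(N : ℚ)| := by
  have h1 : (1 : ℤ) ≤ |N| := Int.one_le_abs h
  have h2 : (1 : ℚ) ≤ |(N : ℚ)| := by exact_mod_cast h1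
  linarith

/-- Multiplying the bound by `B` gives a surplus `B / 4 ≥ D + 2`, more than one pair of digits can
cancel. Hence an error is never repaired. -/
theorem defect_growth_step {N : ℤ} {k : ℕ} (h : (3 / 4 : ℚ) * B ^ k + 1 / 4 ≤ |(N : ℚ)|)
    (l : List S) (a : S) :
    (3 / 4 : ℚ) * B ^ (k + 1) + 1 / 4 ≤ |((B * N + front dig l - dig a : ℤ) : ℚ)| := by
  have h1 := defect_step (B := B) hD (N := N) l a
  have hB' : (4 : ℚ) * D + 8 ≤ B := by exact_mod_cast hB
  have h2 := mul_le_mul_of_nonneg_left h (Nat.cast_nonneg (α := ℚ) B)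
  rw [pow_succ]
  linarith

theorem defect_growth {x : C × List S} {w : ℕ → S} {s k : ℕ} {c : C} {Q : List S} {N : ℤ}
    (hs : follow δ dig B x w s = some (c, Q, N)) (hN : N ≠ 0) :
    ∀ {c' Q' N'}, follow δ dig B x w (s + k) = some (c', Q', N') →
      (3 / 4 : ℚ) * B ^ k + 1 / 4 ≤ |(N' : ℚ)| := by
  induction k with
  | zero =>
    intro c' Q' N' h
    rw [add_zero, hs] at h
    cases h
    exact one_le_abs (B := B) hN
  | succ k ih =>
    intro c' Q' N' h
    rw [← add_assoc, follow, Option.bind_eq_some_iff] at h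
    obtain ⟨⟨c1, Q1, N1⟩, h1, h2⟩ := h
    rw [Option.map_eq_some_iff] at h2
    obtain ⟨r, -, h3⟩ := h2
    cases h3
    exact defect_growth_step hD hB (ih h1) Q1 _

theorem defect_ne_zero {N : ℤ} (h : N ≠ 0) (l : List S) (a : S) :
    (B * N + front dig l - dig a : ℤ) ≠ 0 := by
  intro h0
  have h1 := defect_growth_step hD hB (one_le_abs (B := B) h) l a
  rw [h0] at h1
  have : (0 : ℚ) ≤ (B : ℚ) ^ (0 + 1) := by positivity
  norm_num at h1
  linarith [Nat.cast_nonneg (α := ℚ) B]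

end Val

section Runs

variable (hδ : ∀ x a y l, δ x a = some (y, l) → l ≠ [])

theorem runFor_ne_nil (hδ : ∀ x a y l, δ x a = some (y, l) → l ≠ []) {x : C × List S}
    (hx : x.2 ≠ []) : ∀ {t : ℕ} {y : C × List S}, runFor δ x t = some y → y.2 ≠ [] := by
  intro t
  induction t with
  | zero => intro y h; cases h; exact hx
  | succ t ih =>
    intro y h
    rw [runFor, Option.bind_eq_some_iff] at h
    obtain ⟨⟨c, Q⟩, hz, h⟩ := h
    obtain ⟨a, l, rfl⟩ := List.exists_cons_of_ne_nil (ih hz)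
    simp only [step, Option.map_eq_some_iff] at h
    obtain ⟨r, hr, rfl⟩ := h
    simp [hδ c a r.1 r.2 hr]

variable {D : ℕ} (hD : ∀ a, dig a < D) (hB : 4 * D + 8 ≤ B) (hinj : Function.Injective dig)
include hδ hD hB hinj

/-- A nonzero defect never returns to zero, so a zero defect now means zero defects before. Each
claimed digit was then the true front digit, and digits determine symbols. -/
theorem runFor_of_follow {x : C × List S} (hx : x.2 ≠ []) {w : ℕ → S} :
    ∀ {t : ℕ} {c : C} {Q : List S}, follow δ dig B x w t = some (c, Q, 0) →
      runFor δ x t = some (c, Q) := by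
  intro t
  induction t with
  | zero => intro c Q h; cases h; rfl
  | succ t ih =>
    intro c Q h
    rw [follow, Option.bind_eq_some_iff] at h
    obtain ⟨⟨c1, Q1, N1⟩, h1, h2⟩ := h
    rw [Option.map_eq_some_iff] at h2
    obtain ⟨r, hr, h3⟩ := h2
    simp only [Prod.mk.injEq] at h3
    obtain ⟨rfl, rfl, h4⟩ := h3
    by_cases hN : N1 = 0
    · subst hN
      have h5 := ih h1
      obtain ⟨a, l, hQ⟩ := List.exists_cons_of_ne_nil (runFor_ne_nil hδ hx h5)
      dsimp only at hQ
      subst hQ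
      have h6 : dig a = dig (w t) := by
        simp only [front, mul_zero, zero_add] at h4
        omega
      rw [hinj h6] at h5
      rw [runFor, h5]
      simp only at hr
      simp [step, hr]
    · exact absurd h4 (defect_ne_zero hD hB hN Q1 _)

omit hD hB hinj in
-- The honest word claims the actual front symbol at each time, with arbitrary letters once the
-- machine has halted.
theorem exists_follow_eq_runFor [Nonempty S] {x : C × List S} (hx : x.2 ≠ []) :
    ∃ w : ℕ → S, ∀ t, follow δ dig B x w t = (runFor δ x t).map (fun y => (y.1, y.2, 0)) ∧
      ∀ c a l, runFor δ x t = some (c, a :: l) → w t = a := by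
  classical
  let w : ℕ → S := fun t => match runFor δ x t with
    | some (_, a :: _) => a
    | _ => Classical.arbitrary S
  have hw : ∀ t c a l, runFor δ x t = some (c, a :: l) → w t = a := by
    intro t c a l h
    simp only [w, h]
  refine ⟨w, fun t => ⟨?_, hw t⟩⟩
  induction t with
  | zero => rfl
  | succ t ih =>
    rw [follow, ih, runFor]
    cases h : runFor δ x t with
    | none => rfl
    | some y =>
      obtain ⟨c, Q⟩ := y
      obtain ⟨a, l, hQ⟩ := List.exists_cons_of_ne_nil (runFor_ne_nil hδ hx h)
      dsimp only at hQ
      subst hQ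
      have h1 := hw t c a l h
      simp only [Option.map_some, Option.bind_some, h1, step, front, List.tail_cons,
        Option.map_map]
      congr 1
      funext r
      simp

end Runs

theorem exists_halting_time {x : C × List S} {w : ℕ → S}
    (h : ¬ ∀ t, follow δ dig B x w t ≠ none) :
    ∃ T c Q N, follow δ dig B x w T = some (c, Q, N) ∧ δ c (w T) = none := by
  push Not at h
  obtain ⟨t, ht⟩ := h
  induction t with
  | zero => cases ht
  | succ t ih =>
    cases h : follow δ dig B x w t with
    | none => exact ih h
    | some y =>
      obtain ⟨c, Q, N⟩ := y
      rw [follow, h] at ht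
      exact ⟨t, c, Q, N, h, by simpa using ht⟩

section Payoff

variable [Nonempty S] (hδ : ∀ x a y l, δ x a = some (y, l) → l ≠ [])
  {D : ℕ} (hD : ∀ a, dig a < D) (hB : 4 * D + 8 ≤ B) (hinj : Function.Injective dig)
  {lam κ : ℚ} (hκ : 0 < κ) {x : C × List S} (hx : x.2 ≠ []) {P : (ℕ → S) → ℝ}
include hδ hD hB hinj hκ hx

omit [Nonempty S] hκ in
-- A claimed run still alive after the true run has ended must contain an error, made by time `T +
-- 1`; from there on the defect grows like a power of `B`.
theorem gap_sq_ge_of_halts {T : ℕ} (hT : runFor δ x (T + 1) = none) (w : ℕ → S) {t : ℕ}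
    (ht : T + 1 ≤ t) (hw : follow δ dig B x w t ≠ none) :
    ∃ c Q N, follow δ dig B x w t = some (c, Q, N) ∧
      (3 / 4 : ℚ) * B ^ (t - (T + 1)) + 1 / 4 ≤ |(N : ℚ)| := by
  have h1 : ∀ k, follow δ dig B x w (T + 1) = none → follow δ dig B x w (T + 1 + k) = none := by
    intro k h
    induction k with
    | zero => exact h
    | succ k ih => rw [← add_assoc, follow, ih]; rfl
  obtain ⟨k, rfl⟩ := Nat.exists_eq_add_of_le ht
  cases hs : follow δ dig B x w (T + 1) with
  | none => exact absurd (h1 k hs) hw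
  | some y =>
    obtain ⟨c, Q, N⟩ := y
    obtain ⟨⟨c', Q', N'⟩, hy⟩ := Option.ne_none_iff_exists'.1 hw
    refine ⟨c', Q', N', hy, ?_⟩
    have hN : N ≠ 0 := by
      rintro rfl
      rw [runFor_of_follow hδ hD hB hinj hx hs] at hT
      cases hT
    rw [Nat.add_sub_cancel_left]
    exact defect_growth hD hB hs hN hy

/-- The bonus `1 / 8` separates honest from dishonest halting: with all claims right the scaled
square is at most `1 / 16`, with an error at least `9 / 16`. -/
theorem existence_iff_halts (hP : Pays δ dig B lam κ (1 / 8) x P) :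
    (∃ w, (lam : ℝ) < P w) ↔ Halts δ x := by
  have hB0 : 0 < B := by omega
  constructor
  · rintro ⟨w, hw⟩
    by_cases hh : ∀ t, follow δ dig B x w t ≠ none
    · exfalso
      refine absurd hw (not_lt.2 (le_of_tendsto ((hP w).2 hh) (Eventually.of_forall fun t => ?_)))
      have : lam - κ * gap δ dig B x w t ^ 2 ≤ lam := by
        have := mul_nonneg hκ.le (sq_nonneg (gap δ dig B x w t))
        linarith
      exact_mod_cast this
    · obtain ⟨T, c, Q, N, h1, h2⟩ := exists_halting_time hh
      rw [(hP w).1 T c Q N h1 h2] at hw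
      have hw' := Rat.cast_lt.1 hw
      have h3 : 0 < κ * (1 / 8 - (((B * N + front dig Q - dig (w T) : ℤ) : ℚ) +
          val dig B Q.tail) ^ 2) / ((B : ℚ) ^ (T + 1)) ^ 2 := by linarith
      have h4 : 0 < κ * (1 / 8 - (((B * N + front dig Q - dig (w T) : ℤ) : ℚ) +
          val dig B Q.tail) ^ 2) := by
        by_contra h
        exact absurd h3 (not_lt.2 (div_nonpos_of_nonpos_of_nonneg (not_lt.1 h) (by positivity)))
      have h5 := (pos_iff_pos_of_mul_pos h4).1 hκ
      have h6 : (B * N + front dig Q - dig (w T) : ℤ) = 0 := by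
        by_contra h
        have := abs_add_val hD hB (one_le_abs (B := B) h) Q.tail
        norm_num at this h5
        linarith
      have hN : N = 0 := by
        by_contra h
        exact defect_ne_zero hD hB h Q (w T) h6
      subst hN
      have h7 := runFor_of_follow hδ hD hB hinj hx h1
      obtain ⟨a, l, hQ⟩ := List.exists_cons_of_ne_nil (runFor_ne_nil hδ hx h7)
      dsimp only at hQ
      subst hQ
      have h8 : dig a = dig (w T) := by
        simp only [front, mul_zero, zero_add] at h6
        omega
      refine ⟨(c, a :: l), reaches_iff_runFor.2 ⟨T, h7⟩, ?_⟩
      rw [hinj h8]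
      simp [step, h2]
  · rintro ⟨⟨c, Q⟩, h1, h2⟩
    obtain ⟨T, hT⟩ := reaches_iff_runFor.1 h1
    obtain ⟨w, hw⟩ := exists_follow_eq_runFor (dig := dig) (B := B) hδ hx
    obtain ⟨a, l, hQ⟩ := List.exists_cons_of_ne_nil (runFor_ne_nil hδ hx hT)
    dsimp only at hQ
    subst hQ
    have h3 := (hw T).2 _ _ _ hT
    have h4 := (hw T).1
    rw [hT] at h4
    refine ⟨w, ?_⟩
    rw [(hP w).1 T c _ 0 h4 (by simpa [step, h3] using h2)]
    rw [Rat.cast_lt, h3]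
    have h5 := val_le hD hB l
    have h6 := val_nonneg (dig := dig) (B := B) l
    have h7 : (0 : ℚ) < 1 / 8 - (val dig B l) ^ 2 := by nlinarith
    have h8 : 0 < κ * (1 / 8 - (val dig B l) ^ 2) / ((B : ℚ) ^ (T + 1)) ^ 2 := by positivity
    simpa [front] using h8

omit hκ hinj in
theorem exists_eq_of_not_halts {σ : ℚ} (hP : Pays δ dig B lam κ σ x P) (hh : ¬ Halts δ x) :
    ∃ w, P w = lam := by
  have hB1 : 1 < (B : ℝ) := by exact_mod_cast (by omega : 1 < B)
  rw [halts_iff_runFor] at hh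
  push Not at hh
  obtain ⟨w, hw⟩ := exists_follow_eq_runFor (dig := dig) (B := B) hδ hx
  refine ⟨w, tendsto_nhds_unique ((hP w).2 fun t => ?_) ?_⟩
  · rw [(hw t).1]; simpa using hh t
  have h0 : ∀ t, 0 ≤ gap δ dig B x w t ∧ gap δ dig B x w t ≤ (1 / B : ℚ) ^ t := by
    intro t
    obtain ⟨⟨c, Q⟩, hy⟩ := Option.ne_none_iff_exists'.1 (hh t)
    have h1 := (hw t).1
    rw [hy] at h1
    simp only [gap, h1, Option.map_some, Int.cast_zero, zero_add]
    have h5 := val_le hD hB Q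
    have h6 := val_nonneg (dig := dig) (B := B) Q
    rw [one_div, inv_pow, ← one_div]
    exact ⟨by positivity, by gcongr; linarith⟩
  have h1 : Tendsto (fun t => ((gap δ dig B x w t : ℚ) : ℝ)) atTop (𝓝 0) := by
    refine squeeze_zero (g := fun t => (1 / (B : ℝ)) ^ t) (fun t => by exact_mod_cast (h0 t).1)
      (fun t => ?_) (tendsto_pow_atTop_nhds_zero_of_lt_one (by positivity) ?_)
    · have := (h0 t).2
      have h2 : ((gap δ dig B x w t : ℚ) : ℝ) ≤ (((1 / B : ℚ) ^ t : ℚ) : ℝ) := by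
        exact_mod_cast this
      simpa using h2
    · rw [div_lt_one (by linarith)]; exact hB1
  have h2 := ((h1.pow 2).const_mul (κ : ℝ)).const_sub (lam : ℝ)
  simpa using h2

omit [Nonempty S] in
theorem exists_le_of_halts (hP : Pays δ dig B lam κ (-1) x P) (hh : Halts δ x) :
    ∃ ε : ℝ, 0 < ε ∧ ∀ w, P w ≤ lam - ε := by
  have hB0 : (0 : ℚ) < B := by exact_mod_cast (by omega : 0 < B)
  have hB1 : (1 : ℚ) ≤ B := by exact_mod_cast (by omega : 1 ≤ B)
  obtain ⟨T', hT'⟩ := halts_iff_runFor.1 hh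
  obtain ⟨T, hT⟩ : ∃ T, runFor δ x (T + 1) = none := ⟨T', runFor_antitone (Nat.le_succ _) hT'⟩
  -- This is `κ` times the smallest squared gap that an error made by time `T + 1` can leave.
  set ε : ℚ := κ * (9 / 16) / (B ^ (T + 1)) ^ 2 with hε
  have hε0 : 0 < ε := by positivity
  refine ⟨(ε : ℚ), by exact_mod_cast hε0, fun w => ?_⟩
  have key : ∀ (N : ℤ) (l : List S) (t : ℕ), T + 1 ≤ t →
      (3 / 4 : ℚ) * B ^ (t - (T + 1)) + 1 / 4 ≤ |(N : ℚ)| →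
      ε ≤ κ * ((N + val dig B l) / B ^ t) ^ 2 := by
    intro N l t ht hN
    obtain ⟨k, rfl⟩ := Nat.exists_eq_add_of_le ht
    rw [Nat.add_sub_cancel_left] at hN
    have h1 := abs_add_val hD hB hN l
    rw [hε, mul_div_assoc, div_pow]
    refine mul_le_mul_of_nonneg_left ?_ hκ.le
    rw [div_le_div_iff₀ (by positivity) (by positivity), pow_add, mul_pow]
    have h2 := mul_le_mul_of_nonneg_right h1 (sq_nonneg ((B : ℚ) ^ (T + 1)))
    linarith
  by_cases hw : ∀ t, follow δ dig B x w t ≠ none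
  · refine le_of_tendsto ((hP w).2 hw) ?_
    filter_upwards [eventually_ge_atTop (T + 1)] with t ht
    obtain ⟨c, Q, N, h1, h2⟩ := gap_sq_ge_of_halts hδ hD hB hinj hx hT w ht (hw t)
    have h3 := key N Q t ht h2
    have h4 : lam - κ * gap δ dig B x w t ^ 2 ≤ lam - ε := by
      simp only [gap, h1]; linarith
    exact_mod_cast h4
  · obtain ⟨t, c, Q, N, h1, h2⟩ := exists_halting_time hw
    rw [(hP w).1 t c Q N h1 h2]
    set Z : ℚ := ((B * N + front dig Q - dig (w t) : ℤ) : ℚ) + val dig B Q.tail with hZ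
    have h3 : lam + κ * (-1 - Z ^ 2) / ((B : ℚ) ^ (t + 1)) ^ 2 ≤ lam - ε := by
      have h4 : κ * (-1 - Z ^ 2) / ((B : ℚ) ^ (t + 1)) ^ 2 =
          -(κ / ((B : ℚ) ^ (t + 1)) ^ 2) - κ * (Z / B ^ (t + 1)) ^ 2 := by
        rw [div_pow]; field_simp
      rw [h4]
      -- A run that halts by time `T` loses enough through the penalty alone, honest or not; a later
      -- halt requires an error made by time `T + 1`.
      by_cases ht : t ≤ T
      · have h5 : ε ≤ κ / ((B : ℚ) ^ (t + 1)) ^ 2 := by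
          have h6 : ((B : ℚ) ^ (t + 1)) ^ 2 ≤ (B ^ (T + 1)) ^ 2 := by gcongr
          rw [hε]
          exact div_le_div₀ hκ.le (by linarith) (by positivity) h6
        have h7 : 0 ≤ κ * (Z / B ^ (t + 1)) ^ 2 := by positivity
        linarith
      · obtain ⟨c', Q', N', h5, h6⟩ := gap_sq_ge_of_halts hδ hD hB hinj hx hT w
          (by omega : T + 1 ≤ t) (by rw [h1]; simp)
        rw [h1] at h5
        cases h5
        have h7 := defect_growth_step hD hB h6 Q (w t)
        have h8 := key _ Q.tail (t + 1) (by omega) (by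
          rwa [show t + 1 - (T + 1) = t - (T + 1) + 1 by omega])
        have h9 : 0 ≤ κ / ((B : ℚ) ^ (t + 1)) ^ 2 := by positivity
        linarith
    exact_mod_cast h3

end Payoff

end QueueMachine

/-! ### Matrices with two sinks and prescribed corrections. -/

/-- The transition matrices with two sinks `inr true` and `inr false` in which the mass leaving the
transient states `X` is split in the proportion `lam : 1 - lam`, corrected by `adj`. -/
def payMatrix {S X : Type} [Fintype X] (kern : S → X → X → ℚ) (adj : S → X → ℚ) (lam : ℚ) (a : S) :
    X ⊕ Bool → X ⊕ Bool → ℚ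
  | .inl x, .inl y => kern a x y
  | .inl x, .inr true => lam * (1 - ∑ y, kern a x y) + adj a x
  | .inl x, .inr false => 1 - ∑ y, kern a x y - (lam * (1 - ∑ y, kern a x y) + adj a x)
  | .inr b, .inr b' => if b = b' then 1 else 0
  | .inr _, .inl _ => 0

section PayMatrix

variable {S X : Type} [Fintype X] [DecidableEq X] {kern : S → X → X → ℚ} {adj : S → X → ℚ}
  {lam : ℚ}

omit [DecidableEq X] in
theorem payMatrix_sum (a : S) (q : X ⊕ Bool) :
    ∑ q', payMatrix kern adj lam a q q' = 1 := by
  rcases q with x | b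
  · simp [Fintype.sum_sum_type, payMatrix]
  · simp [Fintype.sum_sum_type, payMatrix]

theorem stateDist_payMatrix_inl (x : X) (w : ℕ → S) (t : ℕ) (y : X) :
    stateDist (payMatrix kern adj lam) (.inl x) w t (.inl y) = stateDist kern x w t y := by
  induction t generalizing y with
  | zero => simp [stateDist, Pi.single_apply]
  | succ t ih => simp [stateDist, Fintype.sum_sum_type, payMatrix, ih]

/-- By linearity, the accepting sink holds the share `lam` of all mass that has left plus all
corrections so far. -/
theorem stateDist_payMatrix_true (x : X) (w : ℕ → S) (t : ℕ) :
    stateDist (payMatrix kern adj lam) (.inl x) w t (.inr true) =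
      lam * (1 - ∑ y, stateDist kern x w t y) +
        ∑ s ∈ Finset.range t, ∑ y, stateDist kern x w s y * adj (w s) y := by
  induction t with
  | zero => simp [stateDist]
  | succ t ih =>
    rw [Finset.sum_range_succ]
    simp only [stateDist, Fintype.sum_sum_type, stateDist_payMatrix_inl, payMatrix,
      Fintype.sum_bool, ih]
    have h : ∑ y, stateDist kern x w (t + 1) y =
        ∑ z, stateDist kern x w t z * ∑ y, kern (w t) z y := by
      simp only [stateDist, Finset.mul_sum]
      exact Finset.sum_comm
    simp only [stateDist] at h
    rw [h]
    simp only [mul_add, Finset.sum_add_distrib, mul_sub, mul_one, Finset.sum_sub_distrib]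
    have h2 : ∀ z, stateDist kern x w t z * (lam * ∑ y, kern (w t) z y) =
        lam * (stateDist kern x w t z * ∑ y, kern (w t) z y) := fun z => by ring
    have h3 : ∀ z, stateDist kern x w t z * lam = lam * stateDist kern x w t z := fun z => by ring
    simp only [h2, h3, ← Finset.mul_sum]
    simp
    ring

theorem stateDist_payMatrix_false (x : X) (w : ℕ → S) (t : ℕ) :
    stateDist (payMatrix kern adj lam) (.inl x) w t (.inr false) =
      1 - ∑ y, stateDist kern x w t y -
        stateDist (payMatrix kern adj lam) (.inl x) w t (.inr true) := by
  have h : ∀ t, ∑ q, stateDist (payMatrix kern adj lam) (.inl x) w t q = 1 := by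
    intro t
    induction t with
    | zero => simp [stateDist]
    | succ t ih =>
      simp only [stateDist]
      rw [Finset.sum_comm]
      simp only [← Finset.mul_sum, payMatrix_sum, mul_one, ih]
  have h1 := h t
  rw [Fintype.sum_sum_type, Fintype.sum_bool] at h1
  simp only [stateDist_payMatrix_inl] at h1
  linarith

theorem tendsto_sum_stateDist (h0 : ∀ a y z, 0 ≤ kern a y z) (h1 : ∀ a y, ∑ z, kern a y z ≤ 3 / 4)
    (x : X) (w : ℕ → S) :
    Filter.Tendsto (fun t => ((∑ y, stateDist kern x w t y : ℚ) : ℝ)) Filter.atTop (nhds 0) := by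
  have h : ∀ t, (∀ y, 0 ≤ stateDist kern x w t y) ∧
      ∑ y, stateDist kern x w t y ≤ (3 / 4) ^ t := by
    intro t
    induction t with
    | zero => exact ⟨fun y => by by_cases hy : y = x <;> simp [stateDist, hy], by simp [stateDist]⟩
    | succ t ih =>
      refine ⟨fun y => Finset.sum_nonneg fun z _ => mul_nonneg (ih.1 z) (h0 _ _ _), ?_⟩
      simp only [stateDist]
      rw [Finset.sum_comm]
      simp only [← Finset.mul_sum]
      refine (Finset.sum_le_sum fun z _ => mul_le_mul_of_nonneg_left (h1 (w t) z) (ih.1 z)).trans ?_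
      rw [← Finset.sum_mul, pow_succ]
      exact mul_le_mul_of_nonneg_right ih.2 (by norm_num)
  refine squeeze_zero (g := fun t => (3 / 4 : ℝ) ^ t)
    (fun t => Rat.cast_nonneg.2 (Finset.sum_nonneg fun y _ => (h t).1 y)) (fun t => ?_)
    (tendsto_pow_atTop_nhds_zero_of_lt_one (by norm_num) (by norm_num))
  exact (Rat.cast_le.2 (h t).2).trans_eq (by push_cast; rfl)

omit [DecidableEq X] in
-- At least `1 / 4` of the mass leaves, so both sinks receive at least `min lam (1 - lam) / 4`
-- before the correction, and `lam * (1 - lam) / 8` is smaller.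
theorem payMatrix_pos (hlam0 : 0 < lam) (hlam1 : lam < 1)
    (h1 : ∀ a y, ∑ z, kern a y z ≤ 3 / 4) (h2 : ∀ a y, |adj a y| ≤ lam * (1 - lam) / 8)
    (a : S) (x : X) (b : Bool) : 0 < payMatrix kern adj lam a (.inl x) (.inr b) := by
  have h3 := h1 a x
  have h4 := abs_le.1 (h2 a x)
  have h5 : lam * (1 / 4) ≤ lam * (1 - ∑ y, kern a x y) :=
    mul_le_mul_of_nonneg_left (by linarith) hlam0.le
  have h6 : (1 - lam) * (1 / 4) ≤ (1 - lam) * (1 - ∑ y, kern a x y) :=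
    mul_le_mul_of_nonneg_left (by linarith) (by linarith)
  have h7 : 0 < lam * (1 - lam) := mul_pos hlam0 (by linarith)
  have h8 : lam * (1 - lam) < lam := by nlinarith
  have h9 : lam * (1 - lam) < 1 - lam := by nlinarith
  cases b <;> simp only [payMatrix] <;> linarith

omit [DecidableEq X] in
theorem payMatrix_nonneg (hlam0 : 0 < lam) (hlam1 : lam < 1) (h0 : ∀ a y z, 0 ≤ kern a y z)
    (h1 : ∀ a y, ∑ z, kern a y z ≤ 3 / 4) (h2 : ∀ a y, |adj a y| ≤ lam * (1 - lam) / 8)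
    (a : S) (q q' : X ⊕ Bool) : 0 ≤ payMatrix kern adj lam a q q' := by
  rcases q with x | b <;> rcases q' with y | b'
  · exact h0 a x y
  · exact (payMatrix_pos hlam0 hlam1 h1 h2 a x b').le
  · exact le_rfl
  · simp only [payMatrix]; split_ifs <;> norm_num

end PayMatrix

/-! ### The transient part: products of weights and numbers. -/

namespace QueueMachine

open Filter Topology

variable {C S : Type} (δ : C → S → Option (C × List S)) (dig : S → ℕ) (B : ℕ)

/-- The decay factors of the weights of the next appended and the next removed digit, when `k`
symbols are appended. -/
def decay (k : ℕ) : Fin 2 → ℚ := ![1 / B ^ k, 1 / B]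

/-- The linear update of the two weights and the appended and the removed number, when `k`
symbols of value `v` are appended and the digit `d` is removed. -/
def update (k : ℕ) (v d : ℚ) : Fin 4 → Fin 4 → ℚ :=
  ![![1 / B ^ k, 0, v, 0], ![0, 1 / B, 0, d / B], ![0, 0, 1, 0], ![0, 0, 0, 1]]

/-- The change of the squared difference of appended and removed number is the product of this
linear form and `changeRight`. -/
def changeLeft (v d : ℚ) : Fin 2 → ℚ := ![v, -(d / B)]

/-- See `changeLeft`. -/
def changeRight (v d : ℚ) : Fin 4 → ℚ := ![v, -(d / B), 2, -2]

/-- The transient states: a start state, and for every control state of the queue machine the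
products of a weight with a weight or number. -/
abbrev Cell (C : Type) : Type := Option (C × Fin 2 × Fin 4)

/-- The weights at the start. -/
def startLeft (Q : List S) : Fin 2 → ℚ := ![1 / B ^ Q.length, 1]

/-- The weights and numbers at the start. -/
def startRight (Q : List S) : Fin 4 → ℚ := ![1 / B ^ Q.length, 1, val dig B Q, 0]

variable [DecidableEq C]

/-- The mass vector that represents the vectors `u` and `v` in the control state `c`. -/
def cellMass (c : C) (u : Fin 2 → ℚ) (v : Fin 4 → ℚ) : Cell C → ℚ
  | none => 0
  -- The factor `1 / 8` scales the initial products to total mass at most `9 / 16`; the factor 8 in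
  -- `adj` undoes it.
  | some (c', i, j) => if c' = c then u i * v j / 8 else 0

/-- The transition matrices between transient states. -/
def kern (x : C × List S) (a : S) : Cell C → Cell C → ℚ
  | _, none => 0
  | none, some z => cellMass x.1 (startLeft B x.2) (startRight dig B x.2) (some z)
  | some (c, i, j), some (c', i', j') =>
    match δ c a with
    | none => 0
    | some (c₁, e) => if c' = c₁ ∧ i' = i then
        decay B e.length i * update B e.length (val dig B e) (dig a) j j' else 0

/-- The corrections of the acceptance probabilities. -/
def adj (κ σ : ℚ) (x : C × List S) (a : S) : Cell C → ℚ
  -- The start state ignores its letter and pays for the initial squared gap, from which the later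
  -- increments telescope.
  | none => -κ * val dig B x.2 ^ 2
  | some (c, i, j) =>
    match δ c a with
    -- At halting nothing is appended, so the value is 0. The cell `(1, 1)` has mass `1 / (8 * B ^
    -- (2 * t))` after `t` simulated steps, so it yields the term `κ * σ / (B ^ (t + 1)) ^ 2`.
    | none => -8 * κ * (changeLeft B 0 (dig a) i * changeRight B 0 (dig a) j) +
        if i = 1 ∧ j = 1 then 8 * κ * σ / B ^ 2 else 0
    | some (_, e) =>
        -8 * κ * (changeLeft B (val dig B e) (dig a) i * changeRight B (val dig B e) (dig a) j)

variable {δ dig B} [Fintype C]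

theorem sum_cellMass (c : C) (u : Fin 2 → ℚ) (v : Fin 4 → ℚ) (f : Cell C → ℚ) :
    ∑ y, cellMass c u v y * f y = ∑ i, ∑ j, u i * v j / 8 * f (some (c, i, j)) := by
  rw [Fintype.sum_option, Fintype.sum_prod_type, Finset.sum_eq_single c]
  · simp [cellMass, Fintype.sum_prod_type]
  · intro c' _ h
    simp [cellMass, h]
  · simp

variable {x : C × List S} {w : ℕ → S}

theorem stateDist_one : stateDist (kern δ dig B x) none w 1 =
    cellMass x.1 (startLeft B x.2) (startRight dig B x.2) := by
  funext y
  simp only [stateDist]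
  rw [Fintype.sum_eq_single none]
  · cases y <;> simp [kern, cellMass]
  · intro z hz; simp [hz]

/-- On the products the transition is the tensor product of `decay` and `update`, and the control
moves deterministically; a product vector on one control state is therefore sent to another such
vector. -/
theorem stateDist_step {t : ℕ} {c c' : C} {u : Fin 2 → ℚ} {v : Fin 4 → ℚ} {e : List S}
    (h : stateDist (kern δ dig B x) none w t = cellMass c u v) (hc : δ c (w t) = some (c', e)) :
    stateDist (kern δ dig B x) none w (t + 1) =
      cellMass c' (fun i => u i * decay B e.length i)
        (fun j' => ∑ j, v j * update B e.length (val dig B e) (dig (w t)) j j') := by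
  funext y
  simp only [stateDist, h, sum_cellMass]
  cases y with
  | none => simp [kern, cellMass]
  | some y =>
    obtain ⟨c₁, i', j'⟩ := y
    simp only [kern, hc, cellMass]
    by_cases hcc : c₁ = c'
    · simp only [hcc, true_and, if_true]
      rw [Finset.sum_eq_single i']
      · simp only [if_true]
        rw [Finset.mul_sum, Finset.sum_div]
        exact Finset.sum_congr rfl fun j _ => by ring
      · intro i _ hi
        simp [Ne.symm hi]
      · simp
    · simp [hcc]

theorem stateDist_step_none {t : ℕ} {c : C} {u : Fin 2 → ℚ} {v : Fin 4 → ℚ}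
    (h : stateDist (kern δ dig B x) none w t = cellMass c u v) (hc : δ c (w t) = none) :
    stateDist (kern δ dig B x) none w (t + 1) = 0 := by
  funext y
  simp only [stateDist, h, sum_cellMass]
  cases y with
  | none => simp [kern]
  | some y =>
    obtain ⟨c₁, i', j'⟩ := y
    simp [kern, hc]

theorem stateDist_zero_of_le {t s : ℕ} (h : stateDist (kern δ dig B x) none w t = 0)
    (hs : t ≤ s) : stateDist (kern δ dig B x) none w s = 0 := by
  induction s, hs using Nat.le_induction with
  | base => exact h
  | succ s _ ih => funext y; simp [stateDist, ih]

section Bounds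

variable (hδ : ∀ x a y l, δ x a = some (y, l) → l ≠ []) {D : ℕ} (hD : ∀ a, dig a < D)
  (hB : 4 * D + 8 ≤ B)

omit [Fintype C] in
theorem kern_nonneg (a : S) (y z : Cell C) : 0 ≤ kern δ dig B x a y z := by
  rcases y with _ | ⟨c, i, j⟩ <;> rcases z with _ | ⟨c', i', j'⟩
  · exact le_rfl
  · have hv := val_nonneg (dig := dig) (B := B) x.2
    have h1 : 0 ≤ startLeft B x.2 i' := by fin_cases i' <;> simp [startLeft]
    have h2 : 0 ≤ startRight dig B x.2 j' := by fin_cases j' <;> simp [startRight, hv]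
    simp only [kern, cellMass]
    split_ifs <;> positivity
  · exact le_rfl
  · simp only [kern]
    split
    · exact le_rfl
    · rename_i c₁ e _
      have hv := val_nonneg (dig := dig) (B := B) e
      have h1 : 0 ≤ decay B e.length i := by fin_cases i <;> simp [decay]
      have h2 : 0 ≤ update B e.length (val dig B e) (dig a) j j' := by
        fin_cases j <;> fin_cases j' <;> (simp [update, hv]; try positivity)
      split_ifs <;> positivity

include hD hB

theorem digit_div_le (a : S) : (dig a : ℚ) / B ≤ 1 / 4 := by
  have hB' : (4 : ℚ) * D + 8 ≤ B := by exact_mod_cast hB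
  have hD0 : (0 : ℚ) ≤ D := Nat.cast_nonneg _
  have hd : (dig a : ℚ) ≤ D := by exact_mod_cast (hD a).le
  rw [div_le_iff₀ (by linarith)]
  linarith

include hδ in
-- The numbers do not shrink, but each product contains a left weight, which decays by at least `1 /
-- B ≤ 1 / 8`; for the append weight this uses that appended words are nonempty. Rows of `update`
-- sum to at most 2.
theorem kern_sum_le (a : S) (y : Cell C) : ∑ z, kern δ dig B x a y z ≤ 3 / 4 := by
  have hB0 : (8 : ℚ) ≤ B := by exact_mod_cast (by omega : 8 ≤ B)
  have hpow : ∀ k : ℕ, 1 / (B : ℚ) ^ k ≤ 1 := fun k => by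
    rw [div_le_one (by positivity)]
    exact one_le_pow₀ (by linarith)
  have hinv : 1 / (B : ℚ) ≤ 1 / 8 := one_div_le_one_div_of_le (by norm_num) hB0
  rcases y with _ | ⟨c, i, j⟩
  · have h1 := sum_cellMass x.1 (startLeft B x.2) (startRight dig B x.2) (fun _ => 1)
    simp only [mul_one] at h1
    have h2 : ∀ z, kern δ dig B x a none z =
        cellMass x.1 (startLeft B x.2) (startRight dig B x.2) z := by
      intro z; cases z <;> rfl
    simp only [h2, h1]
    have h3 : ∑ i, ∑ j, startLeft B x.2 i * startRight dig B x.2 j / 8 =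
        (1 / B ^ x.2.length + 1) * (1 / B ^ x.2.length + 1 + val dig B x.2) / 8 := by
      simp only [Fin.sum_univ_succ, startLeft, startRight]
      simp
      ring
    rw [h3]
    have h4 := hpow x.2.length
    have h5 := val_le hD hB x.2
    have h6 := val_nonneg (dig := dig) (B := B) x.2
    have h7 : (1 / (B : ℚ) ^ x.2.length + 1) * (1 / B ^ x.2.length + 1 + val dig B x.2) ≤
        2 * (9 / 4) := mul_le_mul (by linarith) (by linarith) (by positivity) (by norm_num)
    linarith
  · simp only [Fintype.sum_option, kern, zero_add]
    split
    · norm_num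
    · rename_i c₁ e he
      rw [Fintype.sum_prod_type, Finset.sum_eq_single c₁ (fun c' _ h => by simp [h]) (by simp),
        Fintype.sum_prod_type, Finset.sum_eq_single i (fun i' _ h => by simp [h]) (by simp)]
      simp only [and_self, if_true]
      rw [← Finset.mul_sum]
      have hv := val_nonneg (dig := dig) (B := B) e
      have hv4 := val_le hD hB e
      have hd := digit_div_le hD hB a
      have hd0 : (0 : ℚ) ≤ dig a / B := by positivity
      have h1 : 0 ≤ decay B e.length i := by fin_cases i <;> simp [decay]
      have h2 : decay B e.length i ≤ 1 / 8 := by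
        have h4 : 1 / (B : ℚ) ^ e.length ≤ 1 / B :=
          one_div_le_one_div_of_le (by positivity) (le_self_pow₀ (by linarith)
            (by simpa using hδ _ _ _ _ he))
        fin_cases i
        · exact h4.trans hinv
        · exact hinv
      have h3 : ∑ j', update B e.length (val dig B e) (dig a) j j' ≤ 2 := by
        have h4 := hpow e.length
        rw [one_div] at h4 hinv
        fin_cases j <;> simp [Fin.sum_univ_succ, update] <;> linarith
      have h4 : 0 ≤ ∑ j', update B e.length (val dig B e) (dig a) j j' :=
        Finset.sum_nonneg fun j' _ => by
          fin_cases j <;> fin_cases j' <;> (simp [update, hv]; try positivity)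
      have h5 := mul_le_mul h2 h3 h4 (by norm_num)
      linarith

omit [DecidableEq C] [Fintype C] in
theorem abs_change_le {r : ℚ} (hr0 : 0 ≤ r) (hr : r ≤ 1 / 4) (a : S) (i : Fin 2) (j : Fin 4) :
    |changeLeft B r (dig a) i * changeRight B r (dig a) j| ≤ 1 / 2 := by
  have hd := digit_div_le hD hB a
  have hd0 : (0 : ℚ) ≤ dig a / B := by positivity
  have h1 : |changeLeft B r (dig a) i| ≤ 1 / 4 := by
    fin_cases i
    · change |r| ≤ _; rwa [abs_of_nonneg hr0]
    · change |-((dig a : ℚ) / B)| ≤ _; rwa [abs_neg, abs_of_nonneg hd0]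
  have h2 : |changeRight B r (dig a) j| ≤ 2 := by
    fin_cases j
    · change |r| ≤ _; rw [abs_of_nonneg hr0]; linarith
    · change |-((dig a : ℚ) / B)| ≤ _; rw [abs_neg, abs_of_nonneg hd0]; linarith
    · change |(2 : ℚ)| ≤ _; norm_num
    · change |(-2 : ℚ)| ≤ _; norm_num
  rw [abs_mul]
  exact (mul_le_mul h1 h2 (abs_nonneg _) (by norm_num)).trans_eq (by norm_num)

omit [DecidableEq C] [Fintype C] in
theorem abs_adj_le {κ σ : ℚ} (hκ : 0 ≤ κ) (hσ : |σ| ≤ 1) (a : S) (y : Cell C) :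
    |adj δ dig B κ σ x a y| ≤ 8 * κ := by
  rcases y with _ | ⟨c, i, j⟩
  · have h1 := val_nonneg (dig := dig) (B := B) x.2
    have h2 := val_le hD hB x.2
    have h3 : val dig B x.2 ^ 2 ≤ 1 := pow_le_one₀ h1 (by linarith)
    simp only [adj, neg_mul, abs_neg]
    rw [abs_of_nonneg (by positivity)]
    nlinarith
  · have key : ∀ r : ℚ, 0 ≤ r → r ≤ 1 / 4 →
        |-8 * κ * (changeLeft B r (dig a) i * changeRight B r (dig a) j)| ≤ 4 * κ := by
      intro r h0 h1
      have h2 := abs_change_le hD hB h0 h1 a i j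
      rw [abs_mul, abs_mul, abs_of_nonneg hκ]
      norm_num
      rw [← abs_mul]
      nlinarith
    simp only [adj]
    split
    · refine (abs_add_le _ _).trans ?_
      have h1 := key 0 le_rfl (by norm_num)
      have h2 : |if i = 1 ∧ j = 1 then 8 * κ * σ / (B : ℚ) ^ 2 else 0| ≤ 4 * κ := by
        split_ifs
        · have hB0 : (8 : ℚ) ≤ B := by exact_mod_cast (by omega : 8 ≤ B)
          rw [abs_div, abs_mul, abs_of_nonneg (by positivity : 0 ≤ 8 * κ),
            abs_of_nonneg (by positivity : 0 ≤ (B : ℚ) ^ 2), div_le_iff₀ (by positivity)]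
          have h3 : (64 : ℚ) ≤ (B : ℚ) ^ 2 := by nlinarith
          have h4 := mul_le_mul_of_nonneg_left h3 (by positivity : 0 ≤ 4 * κ)
          have h5 := mul_le_mul_of_nonneg_left hσ (by positivity : 0 ≤ 8 * κ)
          linarith
        · simpa using hκ
      linarith
    · rename_i e _
      have := key _ (val_nonneg e) (val_le hD hB e)
      linarith

end Bounds

omit [DecidableEq C] [Fintype C] in
-- With `z = v 2 - v 3` and increment `s = u 0 * r - u 1 * (d / B)` this is `(z + s) ^ 2 - z ^ 2 = s
-- * (2 * z + s)`. The copies `v 0`, `v 1` of the weights let the right factor contain `s`.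
theorem sum_change {u : Fin 2 → ℚ} {v : Fin 4 → ℚ} (h0 : v 0 = u 0) (h1 : v 1 = u 1)
    (κ r d : ℚ) :
    ∑ i, ∑ j, u i * v j / 8 * (-8 * κ * (changeLeft B r d i * changeRight B r d j)) =
      -κ * ((v 2 - v 3 + (u 0 * r - u 1 * (d / B))) ^ 2 - (v 2 - v 3) ^ 2) := by
  simp only [Fin.sum_univ_succ, changeLeft, changeRight]
  simp [h0, h1]
  ring

/-- The total correction received before time `t`. -/
def paid (δ : C → S → Option (C × List S)) (dig : S → ℕ) (B : ℕ) (κ σ : ℚ) (x : C × List S)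
    (w : ℕ → S) (t : ℕ) : ℚ :=
  ∑ s ∈ Finset.range t, ∑ y, stateDist (kern δ dig B x) none w s y * adj δ dig B κ σ x (w s) y

end QueueMachine

/-! ### The automaton follows the claimed run. -/

namespace QueueMachine

open Filter Topology

variable {C S : Type} {δ : C → S → Option (C × List S)} {dig : S → ℕ} {B : ℕ} [DecidableEq C]
  [Fintype C] {x : C × List S} {w : ℕ → S} {κ σ : ℚ}

/-- The state distribution at time `t + 1` and the corrections received until then agree with the
run of the queue machine. -/
structure Tracks (δ : C → S → Option (C × List S)) (dig : S → ℕ) (B : ℕ) (κ σ : ℚ)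
    (x : C × List S) (w : ℕ → S) (t : ℕ) (c : C) (Q : List S) (N : ℤ) (u : Fin 2 → ℚ)
    (v : Fin 4 → ℚ) : Prop where
  dist : stateDist (kern δ dig B x) none w (t + 1) = cellMass c u v
  ne_nil : Q ≠ []
  left_zero : u 0 = 1 / B ^ (t + Q.length)
  left_one : u 1 = 1 / B ^ t
  right_zero : v 0 = u 0
  right_one : v 1 = u 1
  diff : v 2 - v 3 = (N + val dig B Q) / B ^ t
  paid_eq : paid δ dig B κ σ x w (t + 1) = -κ * (v 2 - v 3) ^ 2

variable (hδ : ∀ x a y l, δ x a = some (y, l) → l ≠ []) {D : ℕ} (hD : ∀ a, dig a < D)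
  (hB : 4 * D + 8 ≤ B)
include hD hB

omit hD hB in
theorem tracks_zero (hx : x.2 ≠ []) : Tracks δ dig B κ σ x w 0 x.1 x.2 0 (startLeft B x.2)
    (startRight dig B x.2) where
  dist := stateDist_one
  ne_nil := hx
  left_zero := by simp [startLeft]
  left_one := by simp [startLeft]
  right_zero := rfl
  right_one := rfl
  diff := by simp [startRight]
  paid_eq := by
    rw [paid, Finset.sum_range_one, Fintype.sum_eq_single none]
    · simp [stateDist, adj, startRight]
    · intro y hy; simp [stateDist, hy]

omit hD in
-- Removing the front digit moves it from the fractional part `val` into the integer defect, where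
-- it is compared with the claimed digit.
theorem Tracks.diff_step {t : ℕ} {c : C} {Q : List S} {N : ℤ} {u : Fin 2 → ℚ} {v : Fin 4 → ℚ}
    (h : Tracks δ dig B κ σ x w t c Q N u v) (a : S) (e : List S) :
    v 2 - v 3 + (u 0 * val dig B e - u 1 * (dig a / B)) =
      (((B * N + front dig Q - dig a : ℤ) : ℚ) + val dig B (Q.tail ++ e)) / B ^ (t + 1) := by
  have hB0 : (B : ℚ) ≠ 0 := by
    have : 0 < B := by omega
    positivity
  obtain ⟨b, l, rfl⟩ := List.exists_cons_of_ne_nil h.ne_nil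
  rw [h.diff, h.left_zero, h.left_one, List.tail_cons, val_append (by omega), val, front]
  simp only [List.length_cons, pow_succ, pow_add]
  push_cast
  field_simp
  ring

omit hD hB in
theorem paid_succ {t : ℕ} {c : C} {Q : List S} {N : ℤ} {u : Fin 2 → ℚ} {v : Fin 4 → ℚ}
    (h : Tracks δ dig B κ σ x w t c Q N u v) :
    paid δ dig B κ σ x w (t + 2) = -κ * (v 2 - v 3) ^ 2 +
      ∑ i, ∑ j, u i * v j / 8 * adj δ dig B κ σ x (w (t + 1)) (some (c, i, j)) := by
  rw [← h.paid_eq, paid, Finset.sum_range_succ, h.dist, sum_cellMass]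
  rfl

omit hD in
include hδ in
theorem Tracks.step {t : ℕ} {c c' : C} {Q e : List S} {N : ℤ} {u : Fin 2 → ℚ} {v : Fin 4 → ℚ}
    (h : Tracks δ dig B κ σ x w t c Q N u v) (hc : δ c (w (t + 1)) = some (c', e)) :
    Tracks δ dig B κ σ x w (t + 1) c' (Q.tail ++ e) (B * N + front dig Q - dig (w (t + 1)))
      (fun i => u i * decay B e.length i)
      (fun j' => ∑ j, v j * update B e.length (val dig B e) (dig (w (t + 1))) j j') := by
  have h2 : ∑ j, v j * update B e.length (val dig B e) (dig (w (t + 1))) j 2 =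
      v 2 + u 0 * val dig B e := by
    simp [Fin.sum_univ_succ, update, h.right_zero]; ring
  have h3 : ∑ j, v j * update B e.length (val dig B e) (dig (w (t + 1))) j 3 =
      v 3 + u 1 * (dig (w (t + 1)) / B) := by
    simp [Fin.sum_univ_succ, update, h.right_one]; ring
  have hz := h.diff_step hB (w (t + 1)) e
  have hdiff : v 2 + u 0 * val dig B e - (v 3 + u 1 * (dig (w (t + 1)) / B)) =
      v 2 - v 3 + (u 0 * val dig B e - u 1 * (dig (w (t + 1)) / B)) := by ring
  refine ⟨stateDist_step h.dist hc, ?_, ?_, ?_, ?_, ?_, ?_, ?_⟩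
  · simp [hδ _ _ _ _ hc]
  · obtain ⟨b, l, rfl⟩ := List.exists_cons_of_ne_nil h.ne_nil
    simp only [h.left_zero, decay, List.length_cons, List.tail_cons, List.length_append,
      Matrix.cons_val_zero]
    rw [div_mul_div_comm, one_mul, ← pow_add]
    congr 2
    ring
  · simp only [h.left_one, decay, Matrix.cons_val_one, Matrix.cons_val_fin_one]
    rw [div_mul_div_comm, one_mul, ← pow_succ]
  · simp [Fin.sum_univ_succ, update, h.right_zero, decay]
  · simp [Fin.sum_univ_succ, update, h.right_one, decay]
  · simp only [h2, h3]
    rw [hdiff, hz]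
  · rw [paid_succ h]
    simp only [h2, h3, adj, hc]
    rw [sum_change h.right_zero h.right_one, hdiff]
    ring

omit hD in
theorem Tracks.paid_halt {t : ℕ} {c : C} {Q : List S} {N : ℤ} {u : Fin 2 → ℚ} {v : Fin 4 → ℚ}
    (h : Tracks δ dig B κ σ x w t c Q N u v) (hc : δ c (w (t + 1)) = none) :
    paid δ dig B κ σ x w (t + 2) =
      κ * (σ - (((B * N + front dig Q - dig (w (t + 1)) : ℤ) : ℚ) + val dig B Q.tail) ^ 2) /
        (B ^ (t + 1)) ^ 2 := by
  have hB0 : (B : ℚ) ≠ 0 := by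
    have : 0 < B := by omega
    positivity
  rw [paid_succ h]
  simp only [adj, hc, mul_add, Finset.sum_add_distrib]
  rw [sum_change h.right_zero h.right_one]
  have hz := h.diff_step hB (w (t + 1)) []
  simp only [val, mul_zero, List.append_nil] at hz ⊢
  rw [hz]
  have h1 : ∑ i : Fin 2, ∑ j : Fin 4, u i * v j / 8 *
      (if i = 1 ∧ j = 1 then 8 * κ * σ / (B : ℚ) ^ 2 else 0) = κ * σ / (B ^ (t + 1)) ^ 2 := by
    rw [Finset.sum_eq_single 1, Finset.sum_eq_single 1]
    · simp only [and_self, if_true, h.right_one, h.left_one]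
      rw [pow_succ]
      field_simp
      ring
    · intro j _ hj; simp [hj]
    · simp
    · intro i _ hi; simp [hi]
    · simp
  rw [h1]
  simp only [div_pow]
  ring

omit hD in
include hδ in
theorem exists_tracks (hx : x.2 ≠ []) {t : ℕ} {c : C} {Q : List S} {N : ℤ}
    (h : follow δ dig B x (fun t => w (t + 1)) t = some (c, Q, N)) :
    ∃ u v, Tracks δ dig B κ σ x w t c Q N u v := by
  induction t generalizing c Q N with
  | zero =>
    cases h
    exact ⟨_, _, tracks_zero hx⟩
  | succ t ih =>
    rw [follow, Option.bind_eq_some_iff] at h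
    obtain ⟨⟨c1, Q1, N1⟩, h1, h2⟩ := h
    rw [Option.map_eq_some_iff] at h2
    obtain ⟨r, hr, h3⟩ := h2
    cases h3
    obtain ⟨u, v, huv⟩ := ih h1
    exact ⟨_, _, huv.step hδ hB hr⟩

include hδ in
-- The letter `s` is the one spent in the start state, hence the shift by one between the two words.
theorem pays {lam : ℚ} (hx : x.2 ≠ []) {P : (ℕ → S) → ℝ}
    (hP : ∀ w, Tendsto (fun t => ((stateDist (payMatrix (kern δ dig B x) (adj δ dig B κ σ x) lam)
      (.inl none) w t (.inr true) : ℚ) : ℝ)) atTop (𝓝 (P w))) (s : S) :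
    Pays δ dig B lam κ σ x (fun w => P fun t => Nat.casesOn t s w) := by
  intro w
  set w' : ℕ → S := fun t => Nat.casesOn t s w with hw'
  have hacc : ∀ t, stateDist (payMatrix (kern δ dig B x) (adj δ dig B κ σ x) lam)
      (.inl none) w' t (.inr true) = lam * (1 - ∑ y, stateDist (kern δ dig B x) none w' t y) +
        paid δ dig B κ σ x w' t := fun t => stateDist_payMatrix_true _ _ _
  constructor
  · intro T c Q N h hc
    obtain ⟨u, v, huv⟩ := exists_tracks (κ := κ) (σ := σ) (w := w') hδ hB hx h
    have h0 : stateDist (kern δ dig B x) none w' (T + 2) = 0 := stateDist_step_none huv.dist hc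
    have h1 := huv.paid_halt hB hc
    refine tendsto_nhds_unique (hP w') (tendsto_const_nhds.congr' ?_)
    filter_upwards [eventually_ge_atTop (T + 2)] with t ht
    rw [hacc, stateDist_zero_of_le h0 ht]
    have h2 : paid δ dig B κ σ x w' t = paid δ dig B κ σ x w' (T + 2) := by
      induction t, ht using Nat.le_induction with
      | base => rfl
      | succ t ht ih =>
        rw [← ih, paid, Finset.sum_range_succ, stateDist_zero_of_le h0 ht]
        simp [paid]
    rw [h2, h1]
    simp [hw']
  · intro hh
    -- Adding `lam` times the vanishing transient mass does not change the limit and turns each term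
    -- into exactly `lam - κ * gap ^ 2`.
    have hm := (tendsto_sum_stateDist (kern_nonneg (δ := δ) (dig := dig) (B := B) (x := x))
      (kern_sum_le hδ hD hB) none w').comp (tendsto_add_atTop_nat 1)
    have h1 := ((hP w').comp (tendsto_add_atTop_nat 1)).add (hm.const_mul (lam : ℝ))
    rw [mul_zero, add_zero] at h1
    refine h1.congr fun t => ?_
    obtain ⟨⟨c, Q, N⟩, hy⟩ := Option.ne_none_iff_exists'.1 (hh t)
    obtain ⟨u, v, huv⟩ := exists_tracks (κ := κ) (σ := σ) (w := w') hδ hB hx hy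
    simp only [Function.comp_apply, hacc, huv.paid_eq, gap, hy, huv.diff]
    push_cast
    ring

end QueueMachine

/-! ### Computable sequences of nonnegative rationals. -/

/-- A sequence of nonnegative rational numbers is computable if numerators and denominators are. -/
def ComputableRat (r : ℕ → ℚ) : Prop :=
  ∃ f : ℕ → ℕ × ℕ, Computable f ∧ ∀ n, 0 < (f n).2 ∧ ((f n).1 : ℚ) / (f n).2 = r n

namespace ComputableRat

variable {r s : ℕ → ℚ}

theorem const {q : ℚ} (hq : 0 ≤ q) : ComputableRat fun _ => q := by
  refine ⟨fun _ => (q.num.toNat, q.den), Computable.const _, fun _ => ⟨q.den_pos, ?_⟩⟩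
  have h : ((q.num.toNat : ℤ) : ℚ) = q.num := by
    rw [Int.toNat_of_nonneg (Rat.num_nonneg.2 hq)]
  rw [← Int.cast_natCast, h]
  exact Rat.num_div_den q

theorem add (hr : ComputableRat r) (hs : ComputableRat s) : ComputableRat fun n => r n + s n := by
  obtain ⟨f, hf, hf'⟩ := hr
  obtain ⟨g, hg, hg'⟩ := hs
  have hm := Primrec.nat_mul.to_comp
  refine ⟨fun n => ((f n).1 * (g n).2 + (f n).2 * (g n).1, (f n).2 * (g n).2),
    (Primrec.nat_add.to_comp.comp
      (hm.comp (Computable.fst.comp hf) (Computable.snd.comp hg))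
      (hm.comp (Computable.snd.comp hf) (Computable.fst.comp hg))).pair
      (hm.comp (Computable.snd.comp hf) (Computable.snd.comp hg)),
    fun n => ⟨Nat.mul_pos (hf' n).1 (hg' n).1, ?_⟩⟩
  have h1 : ((f n).2 : ℚ) ≠ 0 := by have := (hf' n).1; positivity
  have h2 : ((g n).2 : ℚ) ≠ 0 := by have := (hg' n).1; positivity
  dsimp only
  rw [← (hf' n).2, ← (hg' n).2, div_add_div _ _ h1 h2]
  push_cast
  rfl

theorem mul (hr : ComputableRat r) (hs : ComputableRat s) : ComputableRat fun n => r n * s n := by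
  obtain ⟨f, hf, hf'⟩ := hr
  obtain ⟨g, hg, hg'⟩ := hs
  have hm := Primrec.nat_mul.to_comp
  refine ⟨fun n => ((f n).1 * (g n).1, (f n).2 * (g n).2),
    (hm.comp (Computable.fst.comp hf) (Computable.fst.comp hg)).pair
      (hm.comp (Computable.snd.comp hf) (Computable.snd.comp hg)),
    fun n => ⟨Nat.mul_pos (hf' n).1 (hg' n).1, ?_⟩⟩
  dsimp only
  rw [← (hf' n).2, ← (hg' n).2, div_mul_div_comm]
  push_cast
  rfl

/-- The order hypothesis makes the truncated subtraction of the cross-multiplied numerators exact.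
-/
theorem sub (hr : ComputableRat r) (hs : ComputableRat s) (h : ∀ n, s n ≤ r n) :
    ComputableRat fun n => r n - s n := by
  obtain ⟨f, hf, hf'⟩ := hr
  obtain ⟨g, hg, hg'⟩ := hs
  have hm := Primrec.nat_mul.to_comp
  refine ⟨fun n => ((f n).1 * (g n).2 - (f n).2 * (g n).1, (f n).2 * (g n).2),
    (Primrec.nat_sub.to_comp.comp
      (hm.comp (Computable.fst.comp hf) (Computable.snd.comp hg))
      (hm.comp (Computable.snd.comp hf) (Computable.fst.comp hg))).pair
      (hm.comp (Computable.snd.comp hf) (Computable.snd.comp hg)),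
    fun n => ⟨Nat.mul_pos (hf' n).1 (hg' n).1, ?_⟩⟩
  have h1 : (0 : ℚ) < (f n).2 := by exact_mod_cast (hf' n).1
  have h2 : (0 : ℚ) < (g n).2 := by exact_mod_cast (hg' n).1
  have h3 := h n
  rw [← (hf' n).2, ← (hg' n).2, div_le_div_iff₀ h2 h1] at h3
  have h4 : (f n).2 * (g n).1 ≤ (f n).1 * (g n).2 := by
    have : (g n).1 * (f n).2 ≤ (f n).1 * (g n).2 := by exact_mod_cast h3
    linarith
  dsimp only
  rw [← (hf' n).2, ← (hg' n).2, div_sub_div _ _ h1.ne' h2.ne', Nat.cast_sub h4]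
  push_cast
  rfl

theorem sum {ι : Type} (A : Finset ι) {r : ι → ℕ → ℚ} (h : ∀ i ∈ A, ComputableRat (r i)) :
    ComputableRat fun n => ∑ i ∈ A, r i n := by
  classical
  induction A using Finset.induction_on with
  | empty => simpa using const le_rfl
  | insert i A hi ih =>
    simp only [Finset.sum_insert hi]
    exact (h i (Finset.mem_insert_self _ _)).add
      (ih fun j hj => h j (Finset.mem_insert_of_mem hj))

/-- The recursion is run on unreduced fractions. -/
theorem of_rec {d B : ℕ} (hB : 0 < B) {r : ℕ → ℚ} (h0 : 0 ≤ r 0)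
    (h : ∀ n, r (n + 1) = (d + r n) / B) : ComputableRat r := by
  let a : ℕ × ℕ := ((r 0).num.toNat, (r 0).den)
  let g : ℕ → ℕ × ℕ → ℕ × ℕ := fun _ p => (d * p.2 + p.1, p.2 * B)
  have hg : Primrec₂ g := by
    have h2 : Primrec fun x : ℕ × ℕ × ℕ => x.2.2 := Primrec.snd.comp Primrec.snd
    have h1 : Primrec fun x : ℕ × ℕ × ℕ => x.2.1 := Primrec.fst.comp Primrec.snd
    exact (Primrec.nat_add.comp (Primrec.nat_mul.comp (Primrec.const d) h2) h1).pair
      (Primrec.nat_mul.comp h2 (Primrec.const B))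
  refine ⟨fun n => Nat.rec a g n, (Primrec.nat_rec₁ a hg).to_comp, fun n => ?_⟩
  induction n with
  | zero =>
    obtain ⟨f, -, hf⟩ := const h0
    refine ⟨(r 0).den_pos, ?_⟩
    have h : (((r 0).num.toNat : ℤ) : ℚ) = (r 0).num := by
      rw [Int.toNat_of_nonneg (Rat.num_nonneg.2 h0)]
    change (((r 0).num.toNat : ℕ) : ℚ) / (r 0).den = _
    rw [← Int.cast_natCast, h]
    exact Rat.num_div_den _
  | succ n ih =>
    have h1 : (0 : ℚ) < ((Nat.rec a g n : ℕ × ℕ).2 : ℚ) := by exact_mod_cast ih.1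
    have h2 : (B : ℚ) ≠ 0 := by positivity
    refine ⟨Nat.mul_pos ih.1 hB, ?_⟩
    rw [h, ← ih.2]
    change ((d * (Nat.rec a g n : ℕ × ℕ).2 + (Nat.rec a g n : ℕ × ℕ).1 : ℕ) : ℚ) /
      (((Nat.rec a g n : ℕ × ℕ).2 * B : ℕ) : ℚ) = _
    push_cast
    field_simp

end ComputableRat

/-! ### Reduction through a computable family of automata. -/

/-- The automaton with states and letters numbered, for given rational matrices. -/
noncomputable def finAutomaton {S T : Type} [Fintype S] [Fintype T] (M : S → T → T → ℚ)
    (h0 : ∀ a q q', 0 ≤ M a q q') (h1 : ∀ a q, ∑ q', M a q q' = 1) (i : T) :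
    ProbAutomaton (Fin (Fintype.card T)) (Fin (Fintype.card S)) where
  init := Fintype.equivFin T i
  trans a q q' := (M ((Fintype.equivFin S).symm a) ((Fintype.equivFin T).symm q)
    ((Fintype.equivFin T).symm q') : ℝ)
  trans_nonneg a q q' := Rat.cast_nonneg.2 (h0 _ _ _)
  trans_sum a q := by
    rw [(Fintype.equivFin T).symm.sum_comp (fun q' => ((M ((Fintype.equivFin S).symm a)
      ((Fintype.equivFin T).symm q) q' : ℚ) : ℝ))]
    exact_mod_cast h1 _ _

section FinAutomaton

variable {S T : Type} [Fintype S] [Fintype T] [DecidableEq T]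

theorem stateDist_finAutomaton (M : S → T → T → ℚ) (h0 : ∀ a q q', 0 ≤ M a q q')
    (h1 : ∀ a q, ∑ q', M a q q' = 1) (i : T) (w : ℕ → S) (t : ℕ) (q : T) :
    stateDist (finAutomaton M h0 h1 i).trans (finAutomaton M h0 h1 i).init
      (fun t => Fintype.equivFin S (w t)) t (Fintype.equivFin T q) =
      ((stateDist M i w t q : ℚ) : ℝ) := by
  induction t generalizing q with
  | zero =>
    by_cases h : q = i
    · subst h; simp [stateDist, finAutomaton]
    · simp [stateDist, finAutomaton, h]
  | succ t ih =>
    simp only [stateDist]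
    rw [← (Fintype.equivFin T).sum_comp]
    simp only [ih]
    simp [finAutomaton]

omit [DecidableEq T] in
/-- A class of automata has an undecidable question if a computable family of automata of the class
reduces an undecidable predicate to it. -/
theorem undecidableFor_of_family [Nonempty S] (M : ℕ → S → T → T → ℚ)
    (hM : ∀ a q q', ComputableRat fun n => M n a q q') (h0 : ∀ n a q q', 0 ≤ M n a q q')
    (h1 : ∀ n a q, ∑ q', M n a q q' = 1) (i : T) (F : Set T) {cls question : AutomatonProperty}
    (hcls : ∀ n, cls _ _ (finAutomaton (M n) (h0 n) (h1 n) i) (Fintype.equivFin T '' F))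
    {H : ℕ → Prop} (hH : ∀ d : ℕ → Bool, Computable d → ¬ ∀ n, d n = true ↔ H n)
    (hq : ∀ n, question _ _ (finAutomaton (M n) (h0 n) (h1 n) i) (Fintype.equivFin T '' F) ↔ H n) :
    UndecidableFor cls question := by
  classical
  rintro ⟨d, hd, hdec⟩
  choose f hf hf' using hM
  set eS := Fintype.equivFin S
  set eT := Fintype.equivFin T
  let code : ℕ → AutomatonCode := fun n => (Fintype.card T, Fintype.card S, (eT i : ℕ),
    ((Finset.univ.filter fun q => q ∈ F).toList.map fun q => (eT q : ℕ)),
    List.ofFn fun a => List.ofFn fun q => List.ofFn fun q' =>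
      f (eS.symm a) (eT.symm q) (eT.symm q') n)
  have hcode : Computable code :=
    (Computable.const _).pair ((Computable.const _).pair ((Computable.const _).pair
      ((Computable.const _).pair (Computable.list_ofFn fun a => Computable.list_ofFn fun q =>
        Computable.list_ofFn fun q' => hf _ _ _))))
  have hfrac : ∀ n (a : Fin (Fintype.card S)) (q q' : Fin (Fintype.card T)),
      (code n).fraction a q q' = f (eS.symm a) (eT.symm q) (eT.symm q') n := by
    intro n a q q'
    simp [code, AutomatonCode.fraction, AutomatonCode.table]
  have hentry : ∀ n (a : Fin (Fintype.card S)) (q q' : Fin (Fintype.card T)),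
      (code n).entry a q q' = M n (eS.symm a) (eT.symm q) (eT.symm q') := by
    intro n a q q'
    rw [AutomatonCode.entry, hfrac, (hf' _ _ _ n).2]
  have hwf : ∀ n, (code n).WellFormed := fun n =>
    { init_lt := (eT i).2
      letters_pos := Fintype.card_pos
      den_pos := fun a ha q hq q' hq' => by
        rw [hfrac n ⟨a, ha⟩ ⟨q, hq⟩ ⟨q', hq'⟩]
        exact (hf' _ _ _ n).1
      row_sum := fun a ha q hq => by
        rw [← Fin.sum_univ_eq_sum_range (fun q' => (code n).entry a q q')]
        have h2 : ∀ q' : Fin (Fintype.card T), (code n).entry a q q' =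
            M n (eS.symm ⟨a, ha⟩) (eT.symm ⟨q, hq⟩) (eT.symm q') :=
          fun q' => hentry n ⟨a, ha⟩ ⟨q, hq⟩ q'
        change ∑ q' : Fin (Fintype.card T), (code n).entry a q q' = 1
        rw [Finset.sum_congr rfl fun q' _ => h2 q', eT.symm.sum_comp
          (fun q' => M n (eS.symm ⟨a, ha⟩) (eT.symm ⟨q, hq⟩) q')]
        exact h1 _ _ _ }
  have haut : ∀ n, (code n).toAutomaton (hwf n) = finAutomaton (M n) (h0 n) (h1 n) i := by
    intro n
    have htr : ((code n).toAutomaton (hwf n)).trans =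
        (finAutomaton (M n) (h0 n) (h1 n) i).trans := by
      funext a q q'
      exact congrArg (Rat.cast : ℚ → ℝ) (hentry n a q q')
    have hin : ((code n).toAutomaton (hwf n)).init = (finAutomaton (M n) (h0 n) (h1 n) i).init :=
      rfl
    -- With both automata generalized, the equality follows by comparing initial states and
    -- matrices.
    revert htr hin
    generalize (code n).toAutomaton (hwf n) = A
    generalize finAutomaton (M n) (h0 n) (h1 n) i = A'
    intro htr hin
    cases A
    cases A'
    subst htr
    subst hin
    rfl
  have hacc : ∀ n, (code n).accepting = eT '' F := by
    intro n
    ext q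
    simp only [AutomatonCode.accepting, AutomatonCode.acceptList, code, Set.mem_ofPred_eq,
      List.mem_map, Finset.mem_toList, Finset.mem_filter, Finset.mem_univ, true_and]
    exact exists_congr fun x => and_congr_right fun _ => Fin.val_inj
  refine hH (fun n => d (code n)) (hd.comp hcode) fun n => ?_
  have h3 := hdec (code n) (hwf n)
  rw [haut n, hacc n] at h3
  exact (h3 (hcls n)).trans (hq n)

end FinAutomaton

/-! ### Acceptance at the sinks. -/

section Sinks

open Filter Topology

variable {S X : Type} [Fintype S] [Fintype X] {kern : S → X → X → ℚ}
  {adj : S → X → ℚ} {lam : ℚ} (h0 : ∀ a q q', 0 ≤ payMatrix kern adj lam a q q') (i : X)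

theorem isAbsorbingState_sink (b : Bool) :
    (finAutomaton (payMatrix kern adj lam) h0 payMatrix_sum (.inl i)).IsAbsorbingState
      (Fintype.equivFin _ (.inr b)) := by
  intro a
  simp [finAutomaton, payMatrix]

theorem isAbsorbing_payMatrix
    (hpos : ∀ a x, 0 < payMatrix kern adj lam a (.inl x) (.inr true)) :
    (finAutomaton (payMatrix kern adj lam) h0 payMatrix_sum (.inl i)).IsAbsorbing := by
  intro a q hq
  obtain ⟨y, rfl⟩ := (Fintype.equivFin (X ⊕ Bool)).surjective q
  rcases y with y | b
  · refine ⟨_, isAbsorbingState_sink h0 i true, ?_⟩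
    simpa [finAutomaton] using hpos _ y
  · exact absurd (isAbsorbingState_sink h0 i b) hq

variable [DecidableEq X]

theorem tendsto_reach_sink (w : ℕ → S) (b : Bool) :
    Tendsto (fun t => ((stateDist (payMatrix kern adj lam) (.inl i) w t (.inr b) : ℚ) : ℝ)) atTop
      (𝓝 ((finAutomaton (payMatrix kern adj lam) h0 payMatrix_sum (.inl i)).acceptProb
        (Reach {Fintype.equivFin _ (.inr b)}) (fun t => Fintype.equivFin S (w t)))) := by
  refine ((finAutomaton _ h0 payMatrix_sum (.inl i)).tendsto_acceptProb_reach
    (isAbsorbingState_sink h0 i b) _).congr fun t => ?_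
  exact stateDist_finAutomaton _ h0 payMatrix_sum _ w t _

theorem acceptProb_safe_eq_reach (hk0 : ∀ a y z, 0 ≤ kern a y z)
    (hk1 : ∀ a y, ∑ z, kern a y z ≤ 3 / 4) (w : ℕ → S) :
    (finAutomaton (payMatrix kern adj lam) h0 payMatrix_sum (.inl i)).acceptProb
        (Safe (Fintype.equivFin _ '' {.inr false}ᶜ)) (fun t => Fintype.equivFin S (w t)) =
      (finAutomaton (payMatrix kern adj lam) h0 payMatrix_sum (.inl i)).acceptProb
        (Reach {Fintype.equivFin _ (.inr true)}) (fun t => Fintype.equivFin S (w t)) := by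
  rw [Set.image_compl_eq (Fintype.equivFin (X ⊕ Bool)).bijective, Set.image_singleton,
    ProbAutomaton.acceptProb_safe_compl]
  have h1 := (tendsto_reach_sink h0 i w false).const_sub 1
  have h2 := (tendsto_reach_sink h0 i w true).add (tendsto_sum_stateDist hk0 hk1 i w)
  rw [add_zero] at h2
  refine tendsto_nhds_unique h1 (h2.congr fun t => ?_)
  rw [stateDist_payMatrix_false]
  push_cast
  ring

end Sinks

theorem UndecidableFor.congr {cls q q' : AutomatonProperty} (h : UndecidableFor cls q)
    (hq : ∀ n m A F, q n m A F ↔ q' n m A F) : UndecidableFor cls q' := by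
  have : q = q' := by
    funext n m A F
    exact propext (hq n m A F)
  rwa [← this]

/-! ### Undecidability from the payoffs. -/

namespace QueueMachine

variable {C S : Type} [Fintype C] [DecidableEq C] [Fintype S] [Nonempty S]
  {δ : C → S → Option (C × List S)} {dig : S → ℕ} {D B : ℕ}
  (hδ : ∀ x a y l, δ x a = some (y, l) → l ≠ []) (hD : ∀ a, dig a < D) (hB : 4 * D + 8 ≤ B)
include hδ hD hB

omit [Fintype S] [Nonempty S] in
-- Only the row of the start state depends on `n`, through the length and value of the queue;
-- nonnegativity of the entries justifies the subtractions.
theorem computableRat_payMatrix {lam κ σ : ℚ} (hlam0 : 0 < lam) (hlam1 : lam < 1) (hκ : 0 ≤ κ)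
    (hκ' : 8 * κ ≤ lam * (1 - lam) / 8) (hσ : |σ| ≤ 1) {c : C} {Q : ℕ → List S}
    (hlen : ComputableRat fun n => 1 / (B : ℚ) ^ (Q n).length)
    (hval : ComputableRat fun n => val dig B (Q n)) (a : S) (q q' : Cell C ⊕ Bool) :
    ComputableRat fun n =>
      payMatrix (kern δ dig B (c, Q n)) (adj δ dig B κ σ (c, Q n)) lam a q q' := by
  have hk : ∀ n a y, ∑ z, kern δ dig B (c, Q n) a y z ≤ 3 / 4 :=
    fun n a y => kern_sum_le hδ hD hB a y
  have ha : ∀ n a y, |adj δ dig B κ σ (c, Q n) a y| ≤ lam * (1 - lam) / 8 :=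
    fun n a y => (abs_adj_le hD hB hκ hσ a y).trans hκ'
  have hnn : ∀ n q q', 0 ≤
      payMatrix (kern δ dig B (c, Q n)) (adj δ dig B κ σ (c, Q n)) lam a q q' :=
    fun n q q' => payMatrix_nonneg hlam0 hlam1 (fun _ _ _ => kern_nonneg _ _ _) (hk n) (ha n) a q q'
  have hconst : (∀ n, payMatrix (kern δ dig B (c, Q n)) (adj δ dig B κ σ (c, Q n)) lam a q q' =
      payMatrix (kern δ dig B (c, Q 0)) (adj δ dig B κ σ (c, Q 0)) lam a q q') →
      ComputableRat fun n =>
        payMatrix (kern δ dig B (c, Q n)) (adj δ dig B κ σ (c, Q n)) lam a q q' := by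
    intro h
    simp only [h]
    exact ComputableRat.const (hnn 0 _ _)
  have hsome : ∀ n z, kern δ dig B (c, Q n) a (some z) = kern δ dig B (c, Q 0) a (some z) := by
    intro n z
    funext y
    cases y <;> rfl
  have hadj : ∀ n z, adj δ dig B κ σ (c, Q n) a (some z) = adj δ dig B κ σ (c, Q 0) a (some z) :=
    fun n z => rfl
  have hkern : ∀ y, ComputableRat fun n => kern δ dig B (c, Q n) a none y := by
    intro y
    have h8 : ComputableRat fun _ => (1 / 8 : ℚ) := .const (by norm_num)
    rcases y with _ | ⟨c', i, j⟩
    · exact .const le_rfl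
    · simp only [kern, cellMass]
      split_ifs
      · have hl : ComputableRat fun n => startLeft B (Q n) i := by
          fin_cases i
          · exact hlen
          · exact .const zero_le_one
        have hr : ComputableRat fun n => startRight dig B (Q n) j := by
          fin_cases j
          · exact hlen
          · exact .const zero_le_one
          · exact hval
          · exact .const le_rfl
        simpa only [mul_one_div] using (hl.mul hr).mul h8
      · exact .const le_rfl
  have hrest : ComputableRat fun n => 1 - ∑ y, kern δ dig B (c, Q n) a none y :=
    (ComputableRat.const zero_le_one).sub (.sum _ fun y _ => hkern y)
      fun n => (hk n a none).trans (by norm_num)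
  have hacc : ComputableRat fun n =>
      payMatrix (kern δ dig B (c, Q n)) (adj δ dig B κ σ (c, Q n)) lam a (.inl none) (.inr true) := by
    have h1 := ((ComputableRat.const hlam0.le).mul hrest).sub
      ((ComputableRat.const hκ).mul (hval.mul hval)) fun n => by
        have := hnn n (.inl none) (.inr true)
        simp only [payMatrix, adj] at this
        linarith
    convert h1 using 2
    simp only [payMatrix, adj]
    ring
  rcases q with (_ | z) | b
  · rcases q' with y | b
    · exact hkern y
    · cases b with
      | true => exact hacc
      | false =>
        exact hrest.sub hacc fun n => by
          have := hnn n (.inl none) (.inr false)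
          simp only [payMatrix] at this ⊢
          linarith
  · refine hconst fun n => ?_
    rcases q' with y | _ | _ <;> simp only [payMatrix, hsome n, hadj n]
  · refine hconst fun n => ?_
    rcases q' with y | _ | _ <;> rfl

/-- A question about the set of acceptance probabilities that amounts, for the payoffs of a queue
machine, to an undecidable predicate of the initial queue is undecidable. -/
theorem undecidableFor_of_pays {lam κ σ : ℚ} (hlam0 : 0 < lam) (hlam1 : lam < 1) (hκ : 0 ≤ κ)
    (hκ' : 8 * κ ≤ lam * (1 - lam) / 8) (hσ : |σ| ≤ 1) {c : C} {Q : ℕ → List S}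
    (hQ : ∀ n, Q n ≠ []) (hlen : ComputableRat fun n => 1 / (B : ℚ) ^ (Q n).length)
    (hval : ComputableRat fun n => val dig B (Q n)) {G : Set ℝ → Prop} {H : ℕ → Prop}
    (hH : ∀ d : ℕ → Bool, Computable d → ¬ ∀ n, d n = true ↔ H n)
    (hG : ∀ n (P : (ℕ → S) → ℝ), (∀ w, P w ≤ 1) →
      (∀ s, Pays δ dig B lam κ σ (c, Q n) (fun w => P fun t => Nat.casesOn t s w)) →
      (G (Set.range P) ↔ H n)) :
    UndecidableFor (fun _ _ A _ => A.IsAbsorbing)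
        (fun _ _ A F => G (Set.range (A.acceptProb (Safe F)))) ∧
      UndecidableFor (fun _ _ A F => A.IsAcceptanceAbsorbing F)
        (fun _ _ A F => G (Set.range (A.acceptProb (Reach F)))) := by
  have hk : ∀ n a y, ∑ z, kern δ dig B (c, Q n) a y z ≤ 3 / 4 :=
    fun n a y => kern_sum_le hδ hD hB a y
  have hk0 : ∀ n a y z, 0 ≤ kern δ dig B (c, Q n) a y z := fun n a y z => kern_nonneg a y z
  have ha : ∀ n a y, |adj δ dig B κ σ (c, Q n) a y| ≤ lam * (1 - lam) / 8 :=
    fun n a y => (abs_adj_le hD hB hκ hσ a y).trans hκ'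
  have hcomp := computableRat_payMatrix (c := c) hδ hD hB hlam0 hlam1 hκ hκ' hσ hlen hval
  have hnn := fun n => payMatrix_nonneg hlam0 hlam1 (hk0 n) (hk n) (ha n)
  have hpos := fun n => payMatrix_pos hlam0 hlam1 (hk n) (ha n)
  set A := fun n => finAutomaton _ (hnn n) payMatrix_sum (.inl none) with hA
  have hrange : ∀ n (Φ : Set (ℕ → Fin (Fintype.card (Cell C ⊕ Bool)))),
      Set.range ((A n).acceptProb Φ) =
        Set.range fun w : ℕ → S => (A n).acceptProb Φ fun t => Fintype.equivFin S (w t) := by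
    intro n Φ
    have hsurj : Function.Surjective fun (w : ℕ → S) t => Fintype.equivFin S (w t) :=
      fun w => ⟨fun t => (Fintype.equivFin S).symm (w t), by simp⟩
    exact (hsurj.range_comp _).symm
  have hmain : ∀ n, G (Set.range ((A n).acceptProb (Reach {Fintype.equivFin _ (.inr true)}))) ↔
      H n := by
    intro n
    rw [hrange]
    exact hG n _ (fun w => measureReal_le_one)
      (pays hδ hD hB (hQ n) fun w => tendsto_reach_sink (hnn n) none w true)
  constructor
  · refine undecidableFor_of_family _ hcomp hnn (fun n => payMatrix_sum) (.inl none)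
      {.inr false}ᶜ (fun n => isAbsorbing_payMatrix (hnn n) none fun a y => hpos n a y true) hH
      fun n => ?_
    rw [← hmain n]
    change G (Set.range ((A n).acceptProb _)) ↔ _
    rw [hrange n (Safe _), hrange n (Reach _)]
    simp only [hA, acceptProb_safe_eq_reach (hnn n) none (hk0 n) (hk n)]
  · refine undecidableFor_of_family _ hcomp hnn (fun n => payMatrix_sum) (.inl none)
      {.inr true} (fun n q hq => ?_) hH fun n => ?_
    · rw [Set.image_singleton, Set.mem_singleton_iff] at hq
      rw [hq]
      exact isAbsorbingState_sink (hnn n) none true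
    · rw [Set.image_singleton]
      exact hmain n

omit [Fintype C] [DecidableEq C] [Fintype S] [Nonempty S] hδ hD in
theorem computableRat_initial (b c e : S) :
    (ComputableRat fun n => 1 / (B : ℚ) ^ (b :: List.replicate n c ++ [e]).length) ∧
      ComputableRat fun n => val dig B (b :: List.replicate n c ++ [e]) := by
  have hB0 : 0 < B := by omega
  constructor
  · refine ComputableRat.of_rec (d := 0) hB0 (by positivity) fun n => ?_
    simp [pow_succ]
    field_simp
  · have h1 : ComputableRat fun n => val dig B (List.replicate n c ++ [e]) :=
      ComputableRat.of_rec (d := dig c) hB0 (val_nonneg _) fun n => rfl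
    have h2 := ((ComputableRat.const (Nat.cast_nonneg (α := ℚ) (dig b))).add h1).mul
      (ComputableRat.const (q := 1 / (B : ℚ)) (by positivity))
    simp only [mul_one_div] at h2
    exact h2

end QueueMachine

/-! ### The four questions. -/

theorem mainTheorem3 (lam : ℚ) (hlam0 : 0 < lam) (hlam1 : lam < 1) :
    -- absorbing automata with safety condition
    (UndecidableFor (fun _ _ A _ => A.IsAbsorbing) (fun _ _ A F => A.Equality (Safe F) lam) ∧
      UndecidableFor (fun _ _ A _ => A.IsAbsorbing) (fun _ _ A F => A.Existence (Safe F) lam) ∧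
      UndecidableFor (fun _ _ A _ => A.IsAbsorbing) (fun _ _ A F => A.Value (Safe F) lam) ∧
      UndecidableFor (fun _ _ A _ => A.IsAbsorbing)
        (fun _ _ A F => A.ApproxValue (Safe F) lam)) ∧
    -- acceptance-absorbing automata with reachability condition
    (UndecidableFor (fun _ _ A F => A.IsAcceptanceAbsorbing F)
        (fun _ _ A F => A.Equality (Reach F) lam) ∧
      UndecidableFor (fun _ _ A F => A.IsAcceptanceAbsorbing F)
        (fun _ _ A F => A.Existence (Reach F) lam) ∧
      UndecidableFor (fun _ _ A F => A.IsAcceptanceAbsorbing F)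
        (fun _ _ A F => A.Value (Reach F) lam) ∧
      UndecidableFor (fun _ _ A F => A.IsAcceptanceAbsorbing F)
        (fun _ _ A F => A.ApproxValue (Reach F) lam)) := by
  classical
  obtain ⟨C, S, hC, hS, δ, c₀, b, c, e, hδ, hund⟩ := TMQueue.exists_undecidable_queueMachine
  have := Fintype.ofFinite C
  have := Fintype.ofFinite S
  have : Nonempty S := ⟨b⟩
  set dig : S → ℕ := fun a => Fintype.equivFin S a with hdig
  set B := 4 * Fintype.card S + 8
  have hD : ∀ a, dig a < Fintype.card S := fun a => (Fintype.equivFin S a).2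
  have hinj : Function.Injective dig := fun a a' h =>
    (Fintype.equivFin S).injective (Fin.val_injective h)
  have hB : 4 * Fintype.card S + 8 ≤ B := le_rfl
  have hlam : 0 < lam * (1 - lam) := mul_pos hlam0 (by linarith)
  set κ := lam * (1 - lam) / 64 with hκdef
  have hκ : 0 < κ := by positivity
  have hκ' : 8 * κ ≤ lam * (1 - lam) / 8 := by rw [hκdef]; linarith
  set Q : ℕ → List S := fun n => b :: List.replicate n c ++ [e] with hQdef
  have hQ : ∀ n, Q n ≠ [] := fun n => by simp [Q]
  obtain ⟨hlen, hval⟩ := QueueMachine.computableRat_initial hB b c e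
  have hund' : ∀ d : ℕ → Bool, Computable d →
      ¬ ∀ n, d n = true ↔ ¬ QueueMachine.Halts δ (c₀, Q n) := by
    intro d hd h
    refine hund (fun n => !d n) (Primrec.not.to_comp.comp hd) fun n => ?_
    have h1 := h n
    change _ ↔ QueueMachine.Halts δ (c₀, Q n)
    cases hdn : d n <;> simp_all
  have hcons : ∀ w : ℕ → S, (fun t => Nat.casesOn t (w 0) fun t => w (t + 1) : ℕ → S) = w := by
    intro w
    funext t
    cases t <;> rfl
  have hexist : ∀ n (P : (ℕ → S) → ℝ), (∀ s, QueueMachine.Pays δ dig B lam κ (1 / 8) (c₀, Q n)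
      (fun w => P fun t => Nat.casesOn t s w)) →
      ((∃ w, (lam : ℝ) < P w) ↔ QueueMachine.Halts δ (c₀, Q n)) := by
    intro n P hP
    rw [← QueueMachine.existence_iff_halts hδ hD hB hinj hκ (hQ n) (hP b)]
    constructor
    · rintro ⟨w, hw⟩
      have h1 := (QueueMachine.existence_iff_halts hδ hD hB hinj hκ (hQ n) (hP (w 0))).1
        ⟨fun t => w (t + 1), by rwa [hcons w]⟩
      exact (QueueMachine.existence_iff_halts hδ hD hB hinj hκ (hQ n) (hP b)).2 h1
    · rintro ⟨w, hw⟩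
      exact ⟨_, hw⟩
  have hequal : ∀ n (P : (ℕ → S) → ℝ), (∀ s, QueueMachine.Pays δ dig B lam κ (-1) (c₀, Q n)
      (fun w => P fun t => Nat.casesOn t s w)) → ¬ QueueMachine.Halts δ (c₀, Q n) →
      ∃ w, P w = lam := by
    intro n P hP hn
    obtain ⟨w, hw⟩ := QueueMachine.exists_eq_of_not_halts hδ hD hB (hQ n) (hP b) hn
    exact ⟨_, hw⟩
  have hless : ∀ n (P : (ℕ → S) → ℝ), (∀ s, QueueMachine.Pays δ dig B lam κ (-1) (c₀, Q n)
      (fun w => P fun t => Nat.casesOn t s w)) → QueueMachine.Halts δ (c₀, Q n) →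
      ∃ ε : ℝ, 0 < ε ∧ ∀ w, P w ≤ lam - ε := by
    intro n P hP hn
    choose ε h0 h1 using fun s =>
      QueueMachine.exists_le_of_halts hδ hD hB hinj hκ (hQ n) (hP s) hn
    -- The margin was obtained for each first letter separately; finiteness of the alphabet gives a
    -- common one.
    obtain ⟨s₀, hs₀⟩ := Finite.exists_min ε
    refine ⟨ε s₀, h0 s₀, fun w => ?_⟩
    have h2 := h1 (w 0) fun t => w (t + 1)
    rw [hcons w] at h2
    linarith [hs₀ (w 0)]
  have hE := QueueMachine.undecidableFor_of_pays hδ hD hB hlam0 hlam1 hκ.le hκ'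
    (σ := 1 / 8) (by norm_num [abs_of_pos]) hQ hlen hval (G := fun R => ∃ y ∈ R, (lam : ℝ) < y) hund
    fun n P _ hP => by
      rw [Set.exists_range_iff]
      exact hexist n P hP
  have hV := QueueMachine.undecidableFor_of_pays hδ hD hB hlam0 hlam1 hκ.le hκ'
    (σ := 1 / 8) (by norm_num [abs_of_pos]) hQ hlen hval (G := fun R => (lam : ℝ) < sSup R) hund
    fun n P hP1 hP => by
      refine Iff.trans ?_ (hexist n P hP)
      -- The bound by 1 matters: the real supremum of an unbounded set is 0 by convention.
      exact lt_ciSup_iff ⟨1, by rintro _ ⟨w, rfl⟩; exact hP1 w⟩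
  have hQe := QueueMachine.undecidableFor_of_pays hδ hD hB hlam0 hlam1 hκ.le hκ'
    (σ := -1) (by norm_num) hQ hlen hval (G := fun R => (lam : ℝ) ∈ R) hund'
    fun n P _ hP => by
      refine ⟨fun ⟨w, hw⟩ hn => ?_, fun hn => hequal n P hP hn⟩
      obtain ⟨ε, h0, h1⟩ := hless n P hP hn
      linarith [h1 w]
  have hA := QueueMachine.undecidableFor_of_pays hδ hD hB hlam0 hlam1 hκ.le hκ'
    (σ := -1) (by norm_num) hQ hlen hval
    (G := fun R => ∀ ε : ℝ, 0 < ε → ∃ y ∈ R, (lam : ℝ) - ε < y) hund'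
    fun n P _ hP => by
      refine ⟨fun h hn => ?_, fun hn ε h0 => ?_⟩
      · obtain ⟨ε, h0, h1⟩ := hless n P hP hn
        obtain ⟨_, ⟨w, rfl⟩, h2⟩ := h ε h0
        linarith [h1 w]
      · obtain ⟨w, hw⟩ := hequal n P hP hn
        exact ⟨_, ⟨w, rfl⟩, by linarith⟩
  refine ⟨⟨hQe.1.congr fun _ _ A F => ?_, hE.1.congr fun _ _ A F => ?_, hV.1.congr fun _ _ A F => ?_,
    hA.1.congr fun _ _ A F => ?_⟩, hQe.2.congr fun _ _ A F => ?_, hE.2.congr fun _ _ A F => ?_,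
    hV.2.congr fun _ _ A F => ?_, hA.2.congr fun _ _ A F => ?_⟩
  · exact Iff.rfl
  · exact Set.exists_range_iff
  · exact Iff.rfl
  · exact forall₂_congr fun ε _ => Set.exists_range_iff
  · exact Iff.rfl
  · exact Set.exists_range_iff
  · exact Iff.rfl
  · exact forall₂_congr fun ε _ => Set.exists_range_iff
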